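/- Let $\mathbb F$ be a field and let $H_n(0)$ be the 0-Hecke algebra of the symmetric group $\mathfrak S_n$ over $\mathbb F$: it is generated by $\pi_1,\dots,\pi_{n-1}$ with relations $\pi_i^2=\pi_i$, $\pi_i\pi_{i+1}\pi_i=\pi_{i+1}\pi_i\pi_{i+1}$, and $\pi_i\pi_j=\pi_j\pi_i$ for $|i-j|>1$. Put $\overline\pi_i:=\pi_i-1$. A composition $\alpha=(\alpha_1,\dots,\alpha_\ell)$ of $n$ (written $\alpha\models n$) has descent set $D(\alpha)=\{\alpha_1,\alpha_1+\alpha_2,\dots,\alpha_1+\cdots+\alpha_{\ell-1}\}$. For $\alpha,\beta\models n$ write $\beta\preceq\alpha$ if $D(\beta)\subseteq D(\alpha)$. Identify a composition $\alpha$ with the ribbon (connected skew diagram without $2\times2$ boxes) whose rows, from bottom to top, have lengths $\alpha_1,\dots,\alpha_\ell$. A generalized ribbon $\alpha^1\oplus\cdots\oplus\alpha^k$ is a skew diagram whose connected components are ribbons $\alpha^1,\dots,\alpha^k$, with $\alpha^{i+1}$ strictly to the northeast of $\alpha^i$. For a generalized ribbon $R$ with $n$ boxes, $\mathbf P_R$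 is the $\mathbb F$-vector space with basis the standard tableaux of shape $R$ (bijective fillings by $1,\dots,n$ with rows increasing from left to right and columns increasing from top to bottom), with the $H_n(0)$-action $$\overline\pi_i(\tau)=\begin{cases}-\tau,& i\text{ is in a higher row of }\tau\text{ than }i+1,\\ 0,& i\text{ is in the same row of }\tau\text{ as }i+1,\\ s_i(\tau),& i\text{ is in a lower row of }\tau\text{ than }i+1,\end{cases}$$ where $s_i(\tau)$ is obtained from $\tau$ by exchanging $i$ and $i+1$. Let $\alpha=(\alpha_1,\dots,\alpha_\ell)\models n$, let $\mathbf M_\alpha:=\mathbf P_{\alpha_1\oplus\cdots\oplus\alpha_\ell}$ (all components one-row ribbons), and let $H_\alpha(0)$ be the subalgebra of $H_n(0)$ generated by $\{\overline\pi_i: i\in\{1,\dots,n-1\}\setminus D(\alpha)\}$. Then $H_\alpha(0)\cong H_{\alpha_1}(0)\otimes\cdots\otimes H_{\alpha_\ell}(0)$ by the algebra isomorphism under which the generator $\overline\pi_p$ of the $r$-th factor corresponds to $\overline\pi_{\alpha_1+\cdots+\alpha_{r-1}+p}$. With $\mathbf P_{\alpha_1}\otimes\cdots\otimes\mathbf P_{\alpha_\ell}$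 regarded as an $H_\alpha(0)$-module through this isomorphism, there are isomorphisms of $H_n(0)$-modules $$\mathbf M_\alpha\;\cong\;\left(\mathbf P_{\alpha_1}\otimes\cdots\otimes\mathbf P_{\alpha_\ell}\right)\uparrow^{H_n(0)}_{H_\alpha(0)}\;\cong\;\bigoplus_{\beta\preceq\alpha}\mathbf P_\beta ,$$ where $N\uparrow^{H_n(0)}_{H_\alpha(0)}:=H_n(0)\otimes_{H_\alpha(0)}N$. -/

import Mathlib

open scoped TensorProduct DirectSum

noncomputable section

/-! ## The 0-Hecke algebra of type A -/

/-- The letter `i`, where `i : Fin (n - 1)` stands for the `(i + 1)`-st simple reflection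
`s_{i+1} = (i+1, i+2)`. Letters are counted from `0`, so `s_{i+1}` swaps the letters `i`, `i + 1`
of `Fin n`. -/
def letter {n : ℕ} (i : Fin (n - 1)) : Fin n := ⟨i, by omega⟩

/-- The letter `i + 1`. -/
def nextLetter {n : ℕ} (i : Fin (n - 1)) : Fin n := ⟨i + 1, by omega⟩

/-- The defining relations of `H_n(0)`: `π_i ^ 2 = π_i` and the braid relations. -/
inductive ZeroHeckeRel (F : Type*) [Field F] (n : ℕ) :
    FreeAlgebra F (Fin (n - 1)) → FreeAlgebra F (Fin (n - 1)) → Prop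
  | idem (i : Fin (n - 1)) :
      ZeroHeckeRel F n (FreeAlgebra.ι F i * FreeAlgebra.ι F i) (FreeAlgebra.ι F i)
  | braid (i j : Fin (n - 1)) (h : (i : ℕ) + 1 = j) :
      ZeroHeckeRel F n
        (FreeAlgebra.ι F i * FreeAlgebra.ι F j * FreeAlgebra.ι F i)
        (FreeAlgebra.ι F j * FreeAlgebra.ι F i * FreeAlgebra.ι F j)
  | comm (i j : Fin (n - 1)) (h : (i : ℕ) + 1 < j) :
      ZeroHeckeRel F n
        (FreeAlgebra.ι F i * FreeAlgebra.ι F j)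
        (FreeAlgebra.ι F j * FreeAlgebra.ι F i)

/-- The 0-Hecke algebra `H_n(0)` of the symmetric group on `n` letters, over the field `F`. -/
abbrev ZeroHecke (F : Type*) [Field F] (n : ℕ) : Type _ := RingQuot (ZeroHeckeRel F n)

/-- The generator `π_{i+1}` of `H_n(0)`. -/
def ZeroHecke.pi (F : Type*) [Field F] {n : ℕ} (i : Fin (n - 1)) : ZeroHecke F n :=
  RingQuot.mkAlgHom F (ZeroHeckeRel F n) (FreeAlgebra.ι F i)

/-- The generator `π̄_{i+1} = π_{i+1} - 1` of `H_n(0)`. -/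
def ZeroHecke.piBar (F : Type*) [Field F] {n : ℕ} (i : Fin (n - 1)) : ZeroHecke F n :=
  ZeroHecke.pi F i - 1

/-! ## Compositions -/

/-- The descent set `{α₁, α₁ + α₂, …, α₁ + ⋯ + α_{ℓ-1}}` of a composition `α`. -/
def descentSet {n : ℕ} (α : Composition n) : Finset ℕ :=
  (Finset.Ico 1 α.length).image α.sizeUpTo

/-- `β ≼ α`: the composition `β` is refined by `α`. -/
def RefinedBy {n : ℕ} (β α : Composition n) : Prop := descentSet β ⊆ descentSet α

/-! ## Generalized ribbons and standard tableaux -/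

/-- A generalized ribbon with `n` boxes. `rows` lists the row lengths from the bottom row to the
top row (rows are counted from `0`), and `glued r = true` means that row `r` and row `r + 1` belong
to the same connected component: the first box of row `r + 1` is then right above the last box of
row `r`. If `glued r = false`, then row `r + 1` lies strictly to the right of row `r`. (The
value of `glued` at the top row plays no role.) The connected components are thus ribbons, each
strictly to the northeast of the previous one. -/
structure GeneralizedRibbon (n : ℕ) where
  rows : Composition n
  glued : Fin rows.length → Bool

namespace GeneralizedRibbon

variable {n : ℕ}

/-- The (connected) ribbon of a composition `α`. -/
def ribbon (α : Composition n) : GeneralizedRibbon n := ⟨α, fun _ => true⟩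

/-- The generalized ribbon `α₁ ⊕ ⋯ ⊕ α_ℓ`, whose components are the one-row ribbons `α_i`. -/
def rowSum (α : Composition n) : GeneralizedRibbon n := ⟨α, fun _ => false⟩

/-- The boxes of a generalized ribbon: a row, and a place in that row (from left to right). -/
abbrev Box (R : GeneralizedRibbon n) : Type := Σ r : Fin R.rows.length, Fin (R.rows.blocksFun r)

/-- The column that contains the first box of row `r`. -/
def startCol (R : GeneralizedRibbon n) (r : Fin R.rows.length) : ℕ :=
  ∑ q ∈ Finset.Iio r, (R.rows.blocksFun q - if R.glued q then 1 else 0)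

/-- The column of a box. -/
def col (R : GeneralizedRibbon n) (b : R.Box) : ℕ := R.startCol b.1 + b.2

end GeneralizedRibbon

/-- A standard tableau of generalized ribbon shape: a bijective filling of the boxes with the `n`
letters such that rows increase from left to right and columns increase from top to bottom. -/
@[ext]
structure StandardTableau {n : ℕ} (R : GeneralizedRibbon n) where
  entry : R.Box ≃ Fin n
  row_lt : ∀ b c : R.Box, b.1 = c.1 → R.col b < R.col c → entry b < entry c
  col_lt : ∀ b c : R.Box, R.col b = R.col c → b.1 < c.1 → entry c < entry b

theorem swap_lt_swap {n : ℕ} (i : Fin (n - 1)) {x y : Fin n} (h : x < y)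
    (h' : ¬ (x = letter i ∧ y = nextLetter i)) :
    Equiv.swap (letter i) (nextLetter i) x < Equiv.swap (letter i) (nextLetter i) y := by
  have h1 : (letter i : ℕ) = i := rfl
  have h2 : (nextLetter i : ℕ) = i + 1 := rfl
  simp only [Equiv.swap_apply_def, Fin.ext_iff, Fin.lt_def] at *
  split_ifs <;> omega

namespace StandardTableau

variable {n : ℕ} {R : GeneralizedRibbon n}

/-- The row that contains the letter `x`; a higher row has a larger index. -/
def row (τ : StandardTableau R) (x : Fin n) : Fin R.rows.length := (τ.entry.symm x).1

theorem row_entry (τ : StandardTableau R) (b : R.Box) : τ.row (τ.entry b) = b.1 := by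
  simp [row]

/-- The tableau `s_{i+1}(τ)`, which is standard if the letter `i` is in a lower row than `i + 1`. -/
def swap (τ : StandardTableau R) (i : Fin (n - 1)) (h : τ.row (letter i) < τ.row (nextLetter i)) :
    StandardTableau R where
  entry := τ.entry.trans (Equiv.swap (letter i) (nextLetter i))
  row_lt b c hbc hc := by
    refine swap_lt_swap i (τ.row_lt b c hbc hc) ?_
    rintro ⟨h1, h2⟩
    rw [← h1, ← h2, row_entry, row_entry, hbc] at h
    exact lt_irrefl _ h
  col_lt b c hbc hc := by
    refine swap_lt_swap i (τ.col_lt b c hbc hc) ?_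
    rintro ⟨h1, h2⟩
    rw [← h1, ← h2, row_entry, row_entry] at h
    exact lt_asymm h hc

theorem row_swap (τ : StandardTableau R) (i : Fin (n - 1)) (h : τ.row (letter i) < τ.row (nextLetter i))
    (x : Fin n) : (τ.swap i h).row x = τ.row (Equiv.swap (letter i) (nextLetter i) x) := by
  simp [row, swap]

theorem row_swap_lo (τ : StandardTableau R) (i : Fin (n - 1)) (h : τ.row (letter i) < τ.row (nextLetter i)) :
    (τ.swap i h).row (letter i) = τ.row (nextLetter i) := by
  rw [row_swap, Equiv.swap_apply_left]

theorem row_swap_hi (τ : StandardTableau R) (i : Fin (n - 1)) (h : τ.row (letter i) < τ.row (nextLetter i)) :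
    (τ.swap i h).row (nextLetter i) = τ.row (letter i) := by
  rw [row_swap, Equiv.swap_apply_right]

theorem row_swap_ne (τ : StandardTableau R) (i : Fin (n - 1)) (h : τ.row (letter i) < τ.row (nextLetter i))
    {x : Fin n} (h1 : x ≠ letter i) (h2 : x ≠ nextLetter i) : (τ.swap i h).row x = τ.row x := by
  rw [row_swap, Equiv.swap_apply_of_ne_of_ne h1 h2]

end StandardTableau

/-! ## The `H_n(0)`-module of a generalized ribbon -/

/-- The space `P_R` with basis the standard tableaux of shape `R`. -/
def RibbonModule (F : Type*) [Field F] {n : ℕ} (R : GeneralizedRibbon n) : Type _ :=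
  StandardTableau R →₀ F

namespace RibbonModule

variable (F : Type*) [Field F] {n : ℕ} (R : GeneralizedRibbon n)

instance : AddCommGroup (RibbonModule F R) :=
  inferInstanceAs (AddCommGroup (StandardTableau R →₀ F))

instance : Module F (RibbonModule F R) :=
  inferInstanceAs (Module F (StandardTableau R →₀ F))

variable {R}

/-- The basis vector of `P_R` given by a standard tableau. -/
def single (τ : StandardTableau R) : RibbonModule F R := Finsupp.single τ 1

/-- The value of `π̄_{i+1}` on a standard tableau. -/
def piBarFun (i : Fin (n - 1)) (τ : StandardTableau R) : RibbonModule F R :=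
  if τ.row (nextLetter i) < τ.row (letter i) then - single F τ
  else if h : τ.row (letter i) < τ.row (nextLetter i) then single F (τ.swap i h)
  else 0

variable (R) in
/-- The operator `π̄_{i+1}` on `P_R`. -/
def piBarEnd (i : Fin (n - 1)) : Module.End F (RibbonModule F R) :=
  Finsupp.linearCombination F (piBarFun F i)

theorem piBarEnd_single (i : Fin (n - 1)) (τ : StandardTableau R) :
    piBarEnd F R i (single F τ) = piBarFun F i τ := by
  unfold piBarEnd single
  exact (Finsupp.linearCombination_single F (1 : F) τ).trans (one_smul F _)

theorem hom_ext {f g : Module.End F (RibbonModule F R)}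
    (h : ∀ τ, f (single F τ) = g (single F τ)) : f = g :=
  Finsupp.lhom_ext' fun τ => LinearMap.ext_ring (h τ)

theorem piBarEnd_higher {i : Fin (n - 1)} {τ : StandardTableau R}
    (h : τ.row (nextLetter i) < τ.row (letter i)) : piBarEnd F R i (single F τ) = - single F τ := by
  rw [piBarEnd_single, piBarFun, if_pos h]

theorem piBarEnd_same {i : Fin (n - 1)} {τ : StandardTableau R}
    (h : τ.row (letter i) = τ.row (nextLetter i)) : piBarEnd F R i (single F τ) = 0 := by
  rw [piBarEnd_single, piBarFun, if_neg (by simp [h]), dif_neg (by simp [h])]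

theorem piBarEnd_lower {i : Fin (n - 1)} {τ : StandardTableau R}
    (h : τ.row (letter i) < τ.row (nextLetter i)) :
    piBarEnd F R i (single F τ) = single F (τ.swap i h) := by
  rw [piBarEnd_single, piBarFun, if_neg h.asymm, dif_pos h]

theorem piBarEnd_sq (i : Fin (n - 1)) :
    piBarEnd F R i * piBarEnd F R i = - piBarEnd F R i := by
  refine hom_ext F fun τ => ?_
  simp only [Module.End.mul_apply, LinearMap.neg_apply]
  rcases lt_trichotomy (τ.row (letter i)) (τ.row (nextLetter i)) with h | h | h
  · rw [piBarEnd_lower F h, piBarEnd_higher F]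
    simpa [StandardTableau.row_swap] using h
  · simp [piBarEnd_same F h]
  · simp [piBarEnd_higher F h]

theorem piBarEnd_comm (i j : Fin (n - 1)) (hij : (i : ℕ) + 1 < j) :
    piBarEnd F R i * piBarEnd F R j = piBarEnd F R j * piBarEnd F R i := by
  have h1 : letter j ≠ letter i := by simp only [letter, ne_eq, Fin.ext_iff]; omega
  have h2 : letter j ≠ nextLetter i := by simp only [letter, nextLetter, ne_eq, Fin.ext_iff]; omega
  have h3 : nextLetter j ≠ letter i := by simp only [letter, nextLetter, ne_eq, Fin.ext_iff]; omega
  have h4 : nextLetter j ≠ nextLetter i := by simp only [nextLetter, ne_eq, Fin.ext_iff]; omega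
  refine hom_ext F fun τ => ?_
  simp only [Module.End.mul_apply]
  have r1 := StandardTableau.row_swap_ne (R := R) (i := i) (h1 := h1) (h2 := h2)
  have r2 := StandardTableau.row_swap_ne (R := R) (i := i) (h1 := h3) (h2 := h4)
  have r3 := StandardTableau.row_swap_ne (R := R) (i := j) (h1 := h1.symm) (h2 := h3.symm)
  have r4 := StandardTableau.row_swap_ne (R := R) (i := j) (h1 := h2.symm) (h2 := h4.symm)
  rcases lt_trichotomy (τ.row (letter i)) (τ.row (nextLetter i)) with h | h | h <;>
  rcases lt_trichotomy (τ.row (letter j)) (τ.row (nextLetter j)) with h' | h' | h' <;>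
  simp [piBarEnd_single, piBarFun, h, h', h.le.not_gt, h'.le.not_gt, r1, r2, r3, r4]
  congr 1
  refine StandardTableau.ext (Equiv.ext fun b => ?_)
  simp only [StandardTableau.swap, Equiv.trans_apply, Equiv.swap_apply_def]
  grind

theorem piBarEnd_braid (i j : Fin (n - 1)) (hij : (i : ℕ) + 1 = j) :
    piBarEnd F R i * piBarEnd F R j * piBarEnd F R i =
      piBarEnd F R j * piBarEnd F R i * piBarEnd F R j := by
  have h0 : letter j = nextLetter i := by simp only [letter, nextLetter, Fin.ext_iff]; omega
  have h1 : letter i ≠ nextLetter i := by simp only [letter, nextLetter, ne_eq, Fin.ext_iff]; omega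
  have h2 : letter i ≠ nextLetter j := by simp only [letter, nextLetter, ne_eq, Fin.ext_iff]; omega
  have h3 : nextLetter i ≠ nextLetter j := by simp only [nextLetter, ne_eq, Fin.ext_iff]; omega
  refine hom_ext F fun τ => ?_
  simp only [Module.End.mul_apply]
  have r1 := StandardTableau.row_swap_lo (R := R) (i := i)
  have r2 := StandardTableau.row_swap_hi (R := R) (i := i)
  have r3 := StandardTableau.row_swap_ne (R := R) (i := i) (h1 := h2.symm) (h2 := h3.symm)
  have r4 (τ : StandardTableau R) (h) : (τ.swap j h).row (nextLetter i) = τ.row (nextLetter j) := by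
    rw [← h0]; exact τ.row_swap_lo j h
  have r5 (τ : StandardTableau R) (h) : (τ.swap j h).row (nextLetter j) = τ.row (nextLetter i) := by
    rw [← h0]; exact τ.row_swap_hi j h
  have r6 := StandardTableau.row_swap_ne (R := R) (i := j) (h1 := h0 ▸ h1) (h2 := h2)
  rcases lt_trichotomy (τ.row (letter i)) (τ.row (nextLetter i)) with h | h | h <;>
  rcases lt_trichotomy (τ.row (nextLetter i)) (τ.row (nextLetter j)) with h' | h' | h' <;>
  rcases lt_trichotomy (τ.row (letter i)) (τ.row (nextLetter j)) with h'' | h'' | h'' <;>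
  try (exfalso; omega)
  all_goals simp [piBarEnd_single, piBarFun, h, h', h'', h.le.not_gt, h'.le.not_gt, h''.le.not_gt, r1, r2, r3,
    r4, r5, r6, h0]
  congr 1
  refine StandardTableau.ext (Equiv.ext fun b => ?_)
  simp only [StandardTableau.swap, Equiv.trans_apply, Equiv.swap_apply_def, h0]
  grind

variable (R) in
/-- The action of `H_n(0)` on `P_R`, in which `π_{i+1} = π̄_{i+1} + 1`. -/
def rep : ZeroHecke F n →ₐ[F] Module.End F (RibbonModule F R) :=
  RingQuot.liftAlgHom F ⟨FreeAlgebra.lift F fun i => piBarEnd F R i + 1, by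
    intro x y h
    induction h with
    | idem i =>
      simp only [map_mul, FreeAlgebra.lift_ι_apply]
      have h := piBarEnd_sq F (R := R) i
      simp only [add_mul, mul_add, one_mul, mul_one, h]
      abel
    | braid i j h =>
      simp only [map_mul, FreeAlgebra.lift_ι_apply]
      have h1 := piBarEnd_sq F (R := R) i
      have h2 := piBarEnd_sq F (R := R) j
      have h3 := piBarEnd_braid F (R := R) i j h
      simp only [add_mul, mul_add, one_mul, mul_one, h1, h2, h3]
      abel
    | comm i j h =>
      simp only [map_mul, FreeAlgebra.lift_ι_apply]
      have h3 := piBarEnd_comm F (R := R) i j h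
      simp only [add_mul, mul_add, one_mul, mul_one, h3]
      abel⟩

instance : Module (ZeroHecke F n) (RibbonModule F R) :=
  Module.compHom _ (rep F R).toRingHom

theorem rep_piBar (i : Fin (n - 1)) : rep F R (ZeroHecke.piBar F i) = piBarEnd F R i := by
  simp [rep, ZeroHecke.piBar, ZeroHecke.pi]

/-- The action on tableaux: `π̄_{i+1}` sends `τ` to `-τ`, `0` or `s_{i+1}(τ)`, according to
whether the letter `i` is in a higher row than, the same row as, or a lower row than the letter
`i + 1`. -/
theorem piBar_smul_single (i : Fin (n - 1)) (τ : StandardTableau R) :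
    ZeroHecke.piBar F i • single F τ = piBarFun F i τ := by
  change rep F R (ZeroHecke.piBar F i) (single F τ) = _
  rw [rep_piBar, piBarEnd_single]

end RibbonModule

/-! ## Parabolic subalgebras, tensor products and induction -/

/-- The parabolic subalgebra `H_α(0)` of `H_n(0)`, generated by the `π̄_d` with
`d ∈ {1, …, n - 1}` not in the descent set of `α`. -/
def parabolic (F : Type*) [Field F] {n : ℕ} (α : Composition n) : Subalgebra F (ZeroHecke F n) :=
  Algebra.adjoin F {x | ∃ i : Fin (n - 1), (i : ℕ) + 1 ∉ descentSet α ∧ x = ZeroHecke.piBar F i}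

/-- The tensor product algebra `H_{α₁}(0) ⊗ ⋯ ⊗ H_{α_ℓ}(0)`. -/
abbrev BlockTensor (F : Type*) [Field F] {n : ℕ} (α : Composition n) : Type _ :=
  ⨂[F] r : Fin α.length, ZeroHecke F (α.blocksFun r)

/-- The index of the generator of `H_n(0)` that corresponds to the `p`-th generator of the factor
`H_{α_r}(0)`: its index is `p` plus the sum of the parts of `α` before the part `r`. -/
def blockIndex {n : ℕ} (α : Composition n) (r : Fin α.length) (p : Fin (α.blocksFun r - 1)) :
    Fin (n - 1) :=
  ⟨α.sizeUpTo r + p, by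
    have h1 := α.sizeUpTo_succ' r
    have h2 := α.sizeUpTo_le (r + 1)
    have h3 := p.2
    omega⟩

/-- The module `P_m` of the one-row ribbon `m`, for `m > 0`. -/
abbrev RowModule (F : Type*) [Field F] (m : ℕ) (h : 0 < m) : Type _ :=
  RibbonModule F (GeneralizedRibbon.ribbon (Composition.single m h))

/-- The space `P_{α₁} ⊗ ⋯ ⊗ P_{α_ℓ}`. -/
abbrev RowTensor (F : Type*) [Field F] {n : ℕ} (α : Composition n) : Type _ :=
  ⨂[F] r : Fin α.length, RowModule F (α.blocksFun r) (α.one_le_blocksFun r)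

/-- The factorwise action of `H_{α₁}(0) ⊗ ⋯ ⊗ H_{α_ℓ}(0)` on `P_{α₁} ⊗ ⋯ ⊗ P_{α_ℓ}`. -/
def rowTensorRep (F : Type*) [Field F] {n : ℕ} (α : Composition n) :
    BlockTensor F α →ₐ[F] Module.End F (RowTensor F α) :=
  PiTensorProduct.liftAlgHom
    ((PiTensorProduct.mapMultilinear F
      (fun r => RowModule F (α.blocksFun r) (α.one_le_blocksFun r))
      (fun r => RowModule F (α.blocksFun r) (α.one_le_blocksFun r))).compLinearMap
        fun r => (RibbonModule.rep F
          (GeneralizedRibbon.ribbon (Composition.single (α.blocksFun r)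
            (α.one_le_blocksFun r)))).toLinearMap)
    (by
      simp only [MultilinearMap.compLinearMap_apply, PiTensorProduct.mapMultilinear_apply,
        Pi.one_apply, AlgHom.toLinearMap_apply, map_one]
      exact PiTensorProduct.map_one)
    (by
      intro x y
      simp only [MultilinearMap.compLinearMap_apply, PiTensorProduct.mapMultilinear_apply,
        Pi.mul_apply, AlgHom.toLinearMap_apply, map_mul]
      exact PiTensorProduct.map_mul _ _)

theorem rowTensorRep_tprod (F : Type*) [Field F] {n : ℕ} (α : Composition n)
    (x : ∀ r : Fin α.length, ZeroHecke F (α.blocksFun r))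
    (v : ∀ r : Fin α.length, RowModule F (α.blocksFun r) (α.one_le_blocksFun r)) :
    rowTensorRep F α (PiTensorProduct.tprod F x) (PiTensorProduct.tprod F v) =
      PiTensorProduct.tprod F fun r => x r • v r := by
  simp only [rowTensorRep, PiTensorProduct.liftAlgHom_apply, PiTensorProduct.lift.tprod,
    MultilinearMap.compLinearMap_apply, PiTensorProduct.mapMultilinear_apply,
    PiTensorProduct.map_tprod]
  rfl

/-- The `A`-submodule of `A ⊗_F N` generated by the elements `a b ⊗ v - a ⊗ b v`, where `b` runs
through the subalgebra `B`, which acts on `N` through `ρ`. -/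
def balancingSubmodule {F A N : Type*} [Field F] [Ring A] [Algebra F A] [AddCommGroup N]
    [Module F N] (B : Subalgebra F A) (ρ : B →ₐ[F] Module.End F N) : Submodule A (A ⊗[F] N) :=
  Submodule.span A {t | ∃ (a : A) (b : B) (v : N), t = (a * b) ⊗ₜ[F] v - a ⊗ₜ[F] (ρ b v)}

/-- The induced `A`-module `A ⊗_B N` of a module `N` over a subalgebra `B` of `A`, where `B` acts
on `N` through `ρ`. (Mathlib's tensor product is over commutative rings only.) -/
abbrev Induced {F A N : Type*} [Field F] [Ring A] [Algebra F A] [AddCommGroup N]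
    [Module F N] (B : Subalgebra F A) (ρ : B →ₐ[F] Module.End F N) : Type _ :=
  (A ⊗[F] N) ⧸ balancingSubmodule B ρ

end

/-! Shape `α₁ ⊕ ⋯ ⊕ α_ℓ` has no two boxes in one column, so a tableau of this shape amounts to the
word that records the row of each letter, and `π̄_i` acts by exchanging adjacent entries of that
word. Thus `M_α` is generated by the base tableau, whose word is weakly increasing, and the only
relations on this generator are that it is killed by `π̄_d` for `d ∉ D(α)`: a vector of any module
with this property is the image of the base tableau under exactly one homomorphism
(`RowSumModule.desc`, `RowSumModule.hom_ext`). Existence is a confluence argument: a word may be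
sorted along different descents, and the commutation and braid relations show that the result does
not depend on the choice (`RowSumModule.orbit_spec`).

Each `P_{α_r}` is a line killed by all generators `π̄_p`, so the tensor product is a line on which
`H_α(0)` acts by the character that kills its generators. The module induced from it has the same
universal generator as `M_α` (`RowModule.inducedEquiv`). The multiplication map from the tensor
product of the `H_{α_r}(0)` to `H_n(0)` has image `H_α(0)`, and it is injective because the
homomorphism with `π_d ↦ 1` for `d ∈ D(α)` splits it.

For the direct sum, reading the boxes row by row turns tableaux of ribbon shape `β` into the
permutations with descent set exactly `D(β)`, and tableaux of shape `α₁ ⊕ ⋯ ⊕ α_ℓ` into those with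
descent set inside `D(α)`. For `β ≼ α`, a ribbon tableau `τ` is sent to the sum of the tableaux
whose letters are in the rows of `τ` once the rows of `α` are merged into those of `β`
(`RibbonModule.toRowSum`). The tableau with the reading word of `τ` is the lexicographically
smallest term (`StandardTableau.readingWord_lt`), so the sum of these maps is surjective by
triangularity, and counting tableaux makes it bijective. -/

noncomputable section

/-! ## Descent sets and blocks of compositions -/

namespace Composition

variable {n : ℕ} (c : Composition n)

theorem index_eq_iff (x : Fin n) (r : Fin c.length) :
    c.index x = r ↔ c.sizeUpTo r ≤ x ∧ (x : ℕ) < c.sizeUpTo (r + 1) := by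
  rw [eq_comm, ← c.mem_range_embedding_iff', c.mem_range_embedding_iff]

theorem index_monotone : Monotone c.index := by
  intro x y hxy
  by_contra h
  have h1 : (c.index y : ℕ) + 1 ≤ c.index x := by simpa using h
  have h2 := c.monotone_sizeUpTo h1
  have h3 : (y : ℕ) < c.sizeUpTo (c.index y + 1) := c.lt_sizeUpTo_index_succ y
  have h4 := c.sizeUpTo_index_le x
  have : (x : ℕ) ≤ y := hxy
  omega

theorem mem_descentSet {d : ℕ} :
    d ∈ descentSet c ↔ ∃ k, 0 < k ∧ k < c.length ∧ c.sizeUpTo k = d := by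
  simp [descentSet, Nat.succ_le_iff, and_assoc]

theorem index_nextLetter_of_mem {i : Fin (n - 1)} (h : (i : ℕ) + 1 ∈ descentSet c) :
    (c.index (nextLetter i) : ℕ) = c.index (letter i) + 1 := by
  obtain ⟨k, hk, hkl, hki⟩ := c.mem_descentSet.1 h
  have h1 : c.index (nextLetter i) = ⟨k, hkl⟩ := by
    rw [index_eq_iff]
    have := c.sizeUpTo_strict_mono hkl
    simp [nextLetter]; omega
  have h2 : c.index (letter i) = ⟨k - 1, by omega⟩ := by
    rw [index_eq_iff]
    have := c.sizeUpTo_strict_mono (show k - 1 < c.length by omega)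
    simp only [letter]
    rw [Nat.sub_add_cancel hk] at this ⊢
    omega
  rw [h1, h2]; simp; omega

theorem index_nextLetter_of_notMem {i : Fin (n - 1)} (h : (i : ℕ) + 1 ∉ descentSet c) :
    c.index (nextLetter i) = c.index (letter i) := by
  rw [index_eq_iff]
  have h1 := c.sizeUpTo_index_le (letter i)
  have h2 := c.lt_sizeUpTo_index_succ (letter i)
  simp only [letter, nextLetter] at h1 h2 ⊢
  refine ⟨by omega, lt_of_le_of_ne h2 fun h3 => h ?_⟩
  rw [mem_descentSet]
  refine ⟨_, Nat.succ_pos _, ?_, h3.symm⟩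
  -- The end of the last block would give `i + 1 = n`, which the range of `i` excludes.
  by_contra h4
  rw [not_lt] at h4
  have := c.sizeUpTo_ofLength_le _ h4
  have := i.2
  simp only [Nat.succ_eq_add_one] at *
  omega

theorem index_nextLetter_eq_iff {i : Fin (n - 1)} :
    c.index (letter i) = c.index (nextLetter i) ↔ (i : ℕ) + 1 ∉ descentSet c := by
  refine ⟨fun h h' => ?_, fun h => (c.index_nextLetter_of_notMem h).symm⟩
  have := c.index_nextLetter_of_mem h'
  rw [← h] at this
  omega

theorem index_nextLetter_le (i : Fin (n - 1)) :
    (c.index (nextLetter i) : ℕ) ≤ c.index (letter i) + 1 := by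
  by_cases h : (i : ℕ) + 1 ∈ descentSet c
  · exact (c.index_nextLetter_of_mem h).le
  · rw [c.index_nextLetter_of_notMem h]; omega

end Composition

section BlockIndex

variable {n : ℕ} (α : Composition n)

theorem letter_blockIndex (r : Fin α.length) (p : Fin (α.blocksFun r - 1)) :
    letter (blockIndex α r p) = α.embedding r (letter p) := by
  ext; simp [letter, blockIndex]

theorem nextLetter_blockIndex (r : Fin α.length) (p : Fin (α.blocksFun r - 1)) :
    nextLetter (blockIndex α r p) = α.embedding r (nextLetter p) := by
  ext; simp [nextLetter, blockIndex, add_assoc]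

theorem index_letter_blockIndex (r : Fin α.length) (p : Fin (α.blocksFun r - 1)) :
    α.index (letter (blockIndex α r p)) = r := by
  rw [letter_blockIndex, α.index_embedding]

theorem blockIndex_notMem_descentSet (r : Fin α.length) (p : Fin (α.blocksFun r - 1)) :
    ((blockIndex α r p : Fin (n - 1)) : ℕ) + 1 ∉ descentSet α := by
  rw [← α.index_nextLetter_eq_iff, letter_blockIndex, nextLetter_blockIndex, α.index_embedding,
    α.index_embedding]

theorem blockIndex_injective :
    Function.Injective fun x : Σ r : Fin α.length, Fin (α.blocksFun r - 1) =>
      blockIndex α x.1 x.2 := by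
  rintro ⟨r, p⟩ ⟨r', p'⟩ h
  have hr : r = r' := by
    rw [← index_letter_blockIndex α r p, ← index_letter_blockIndex α r' p']
    exact congrArg (fun i => α.index (letter i)) h
  subst hr
  have : α.sizeUpTo r + (p : ℕ) = α.sizeUpTo r + p' := congrArg Fin.val h
  simpa [Fin.ext_iff] using this

theorem exists_blockIndex_eq {i : Fin (n - 1)} (h : (i : ℕ) + 1 ∉ descentSet α) :
    ∃ r p, blockIndex α r p = i := by
  have h1 := α.index_nextLetter_of_notMem h
  rw [α.index_eq_iff] at h1
  have h2 := α.sizeUpTo_index_le (letter i)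
  have h3 := α.sizeUpTo_succ' (α.index (letter i))
  simp only [nextLetter, letter] at h1 h2 h3
  refine ⟨α.index (letter i), ⟨i - α.sizeUpTo (α.index (letter i)), ?_⟩, ?_⟩
  · simp only [letter]; omega
  · ext; simp only [blockIndex, letter]; omega

end BlockIndex

/-! ## The 0-Hecke algebra -/

namespace ZeroHecke

variable (F : Type*) [Field F] {n : ℕ}

theorem pi_eq (i : Fin (n - 1)) : pi F i = piBar F i + 1 := by simp [piBar]

theorem pi_idem (i : Fin (n - 1)) : pi F i * pi F i = pi F i := by
  simpa [pi] using RingQuot.mkAlgHom_rel F (ZeroHeckeRel.idem (F := F) i)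

theorem pi_braid {i j : Fin (n - 1)} (h : (i : ℕ) + 1 = j) :
    pi F i * pi F j * pi F i = pi F j * pi F i * pi F j := by
  simpa [pi] using RingQuot.mkAlgHom_rel F (ZeroHeckeRel.braid (F := F) i j h)

theorem pi_comm {i j : Fin (n - 1)} (h : (i : ℕ) + 1 < j) :
    pi F i * pi F j = pi F j * pi F i := by
  simpa [pi] using RingQuot.mkAlgHom_rel F (ZeroHeckeRel.comm (F := F) i j h)

theorem piBar_sq (i : Fin (n - 1)) : piBar F i * piBar F i = - piBar F i := by
  have h := pi_idem F i
  simp only [piBar, sub_mul, mul_sub, h]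
  noncomm_ring

theorem piBar_comm {i j : Fin (n - 1)} (h : (i : ℕ) + 1 < j) :
    piBar F i * piBar F j = piBar F j * piBar F i := by
  have h := pi_comm F h
  simp only [piBar, sub_mul, mul_sub, h]
  noncomm_ring

theorem piBar_braid {i j : Fin (n - 1)} (h : (i : ℕ) + 1 = j) :
    piBar F i * piBar F j * piBar F i = piBar F j * piBar F i * piBar F j := by
  have h := pi_braid F h
  simp only [piBar, sub_mul, mul_sub, h, pi_idem, mul_one, one_mul]
  noncomm_ring

variable {F}

/-- The algebra homomorphism out of `H_n(0)` given by elements that satisfy its relations. -/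
def lift {S : Type*} [Semiring S] [Algebra F S] (f : Fin (n - 1) → S)
    (idem : ∀ i, f i * f i = f i)
    (braid : ∀ i j : Fin (n - 1), (i : ℕ) + 1 = j → f i * f j * f i = f j * f i * f j)
    (comm : ∀ i j : Fin (n - 1), (i : ℕ) + 1 < j → f i * f j = f j * f i) :
    ZeroHecke F n →ₐ[F] S :=
  RingQuot.liftAlgHom F ⟨FreeAlgebra.lift F f, by
    intro x y h
    induction h with
    | idem i => simpa using idem i
    | braid i j h => simpa using braid i j h
    | comm i j h => simpa using comm i j h⟩

@[simp]
theorem lift_pi {S : Type*} [Semiring S] [Algebra F S] (f : Fin (n - 1) → S)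
    (idem braid comm) (i : Fin (n - 1)) : lift (F := F) f idem braid comm (pi F i) = f i := by
  simp [lift, pi]

theorem algHom_ext {S : Type*} [Semiring S] [Algebra F S] {f g : ZeroHecke F n →ₐ[F] S}
    (h : ∀ i, f (pi F i) = g (pi F i)) : f = g := by
  refine RingQuot.ringQuot_ext' F _ _ (FreeAlgebra.hom_ext (funext fun i => ?_))
  exact h i

@[elab_as_elim]
theorem induction {P : ZeroHecke F n → Prop} (algebraMap : ∀ c, P (algebraMap F _ c))
    (piBar : ∀ i, P (piBar F i)) (add : ∀ a b, P a → P b → P (a + b))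
    (mul : ∀ a b, P a → P b → P (a * b)) (a : ZeroHecke F n) : P a := by
  obtain ⟨x, rfl⟩ := RingQuot.mkAlgHom_surjective F (ZeroHeckeRel F n) a
  induction x with
  | grade0 c => rw [AlgHom.commutes]; exact algebraMap c
  | grade1 i =>
    have h := add _ _ (piBar i) (algebraMap 1)
    rwa [map_one, ← pi_eq] at h
  | mul a b ha hb => rw [map_mul]; exact mul _ _ ha hb
  | add a b ha hb => rw [map_add]; exact add _ _ ha hb

end ZeroHecke

/-! ## The parabolic subalgebra as a tensor product -/

section Parabolic

variable (F : Type*) [Field F] {n : ℕ} (α : Composition n)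

/-- The embedding of the factor `H_{α_r}(0)` into `H_n(0)`. -/
def blockHom (r : Fin α.length) : ZeroHecke F (α.blocksFun r) →ₐ[F] ZeroHecke F n :=
  ZeroHecke.lift (fun p => ZeroHecke.pi F (blockIndex α r p))
    (fun _ => ZeroHecke.pi_idem F _)
    (fun _ _ h => ZeroHecke.pi_braid F (by simp only [blockIndex]; omega))
    (fun _ _ h => ZeroHecke.pi_comm F (by simp only [blockIndex]; omega))

theorem blockHom_pi (r : Fin α.length) (p : Fin (α.blocksFun r - 1)) :
    blockHom F α r (ZeroHecke.pi F p) = ZeroHecke.pi F (blockIndex α r p) := by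
  simp [blockHom]

theorem blockHom_piBar (r : Fin α.length) (p : Fin (α.blocksFun r - 1)) :
    blockHom F α r (ZeroHecke.piBar F p) = ZeroHecke.piBar F (blockIndex α r p) := by
  simp [ZeroHecke.piBar, blockHom_pi]

theorem blockIndex_add_one_lt {r s : Fin α.length} (h : r < s) (p : Fin (α.blocksFun r - 1))
    (q : Fin (α.blocksFun s - 1)) :
    ((blockIndex α r p : Fin (n - 1)) : ℕ) + 1 < blockIndex α s q := by
  have h1 : (r : ℕ) + 1 ≤ s := h
  have h2 := α.monotone_sizeUpTo h1
  have h3 := α.sizeUpTo_succ' r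
  have h4 := p.2
  simp only [blockIndex]
  omega

theorem commute_piBar_blockIndex {r s : Fin α.length} (h : r ≠ s) (p : Fin (α.blocksFun r - 1))
    (q : Fin (α.blocksFun s - 1)) :
    Commute (ZeroHecke.piBar F (blockIndex α r p)) (ZeroHecke.piBar F (blockIndex α s q)) := by
  rcases lt_or_gt_of_ne h with h | h
  · exact ZeroHecke.piBar_comm F (blockIndex_add_one_lt α h p q)
  · exact (ZeroHecke.piBar_comm F (blockIndex_add_one_lt α h q p)).symm

theorem commute_blockHom {r s : Fin α.length} (h : r ≠ s) (x : ZeroHecke F (α.blocksFun r))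
    (y : ZeroHecke F (α.blocksFun s)) : Commute (blockHom F α r x) (blockHom F α s y) := by
  induction x using ZeroHecke.induction with
  | algebraMap c => rw [AlgHom.commutes]; exact Algebra.commutes c _
  | add a b ha hb => rw [map_add]; exact ha.add_left hb
  | mul a b ha hb => rw [map_mul]; exact ha.mul_left hb
  | piBar p =>
    induction y using ZeroHecke.induction with
    | algebraMap c => rw [AlgHom.commutes]; exact (Algebra.commutes c _).symm
    | add a b ha hb => rw [map_add]; exact ha.add_right hb
    | mul a b ha hb => rw [map_mul]; exact ha.mul_right hb
    | piBar q => rw [blockHom_piBar, blockHom_piBar]; exact commute_piBar_blockIndex F α h p q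

/-- The product of the embeddings of the factors, as a homomorphism of monoids. -/
def blockMonoidHom : (∀ r : Fin α.length, ZeroHecke F (α.blocksFun r)) →* ZeroHecke F n :=
  MonoidHom.noncommPiCoprod (fun r => (blockHom F α r : _ →* ZeroHecke F n))
    fun _ _ h x y => commute_blockHom F α h x y

/-- Multiplicativity is known for the product of commuting factors and multilinearity for the
ordered product; this identity lets `blockTensorHom` have both. -/
theorem blockMonoidHom_apply (x : ∀ r : Fin α.length, ZeroHecke F (α.blocksFun r)) :
    blockMonoidHom F α x = (List.ofFn fun r => blockHom F α r (x r)).prod := by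
  rw [List.ofFn_eq_map, ← Multiset.noncommProd_coe]
  · rfl
  · intro a ha b hb hab
    simp only [Multiset.mem_coe, List.mem_map, List.mem_finRange, true_and, Set.mem_ofPred] at ha hb
    obtain ⟨r, rfl⟩ := ha
    obtain ⟨s, rfl⟩ := hb
    exact commute_blockHom F α (fun h => hab (by subst h; rfl)) _ _

/-- The homomorphism `H_{α₁}(0) ⊗ ⋯ ⊗ H_{α_ℓ}(0) → H_n(0)`. -/
def blockTensorHom : BlockTensor F α →ₐ[F] ZeroHecke F n :=
  PiTensorProduct.liftAlgHom
    ((MultilinearMap.mkPiAlgebraFin F α.length (ZeroHecke F n)).compLinearMap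
      fun r => (blockHom F α r).toLinearMap)
    (by simp)
    (fun x y => by simpa [blockMonoidHom_apply] using map_mul (blockMonoidHom F α) x y)

theorem blockTensorHom_tprod (x : ∀ r : Fin α.length, ZeroHecke F (α.blocksFun r)) :
    blockTensorHom F α (PiTensorProduct.tprod F x) = blockMonoidHom F α x := by
  simp [blockTensorHom, blockMonoidHom_apply]

theorem blockTensorHom_single (r : Fin α.length) (x : ZeroHecke F (α.blocksFun r)) :
    blockTensorHom F α (PiTensorProduct.singleAlgHom r x) = blockHom F α r x := by
  refine (blockTensorHom_tprod F α _).trans ?_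
  exact MonoidHom.noncommPiCoprod_mulSingle (N := fun r => ZeroHecke F (α.blocksFun r)) _ r x

open Classical in
/-- The image of `π_{i+1}` under the retraction of `H_n(0)` onto its parabolic subalgebra. -/
def blockRetractFun (i : Fin (n - 1)) : BlockTensor F α :=
  if h : ∃ x : Σ r : Fin α.length, Fin (α.blocksFun r - 1), blockIndex α x.1 x.2 = i then
    PiTensorProduct.singleAlgHom h.choose.1 (ZeroHecke.pi F h.choose.2)
  else 1

theorem blockRetractFun_blockIndex (r : Fin α.length) (p : Fin (α.blocksFun r - 1)) :
    blockRetractFun F α (blockIndex α r p) =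
      PiTensorProduct.singleAlgHom r (ZeroHecke.pi F p) := by
  have h : ∃ x : Σ r : Fin α.length, Fin (α.blocksFun r - 1),
    blockIndex α x.1 x.2 = blockIndex α r p := ⟨⟨r, p⟩, rfl⟩
  rw [blockRetractFun, dif_pos h]
  have h' : h.choose = ⟨r, p⟩ := blockIndex_injective α h.choose_spec
  rw [h']

theorem blockRetractFun_of_mem {i : Fin (n - 1)} (h : (i : ℕ) + 1 ∈ descentSet α) :
    blockRetractFun F α i = 1 := by
  rw [blockRetractFun, dif_neg]
  rintro ⟨x, rfl⟩
  exact blockIndex_notMem_descentSet α _ _ h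

theorem commute_singleAlgHom {r s : Fin α.length} (h : r ≠ s) (x : ZeroHecke F (α.blocksFun r))
    (y : ZeroHecke F (α.blocksFun s)) :
    Commute (PiTensorProduct.singleAlgHom (R := F)
      (A := fun r : Fin α.length => ZeroHecke F (α.blocksFun r)) r x)
      (PiTensorProduct.singleAlgHom s y) := by
  exact Commute.tprod
    (Pi.mulSingle_commute (f := fun r : Fin α.length => ZeroHecke F (α.blocksFun r)) h x y)

theorem blockRetractFun_idem (i : Fin (n - 1)) :
    blockRetractFun F α i * blockRetractFun F α i = blockRetractFun F α i := by
  by_cases hi : (i : ℕ) + 1 ∈ descentSet α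
  · rw [blockRetractFun_of_mem F α hi, one_mul]
  · obtain ⟨r, p, rfl⟩ := exists_blockIndex_eq α hi
    rw [blockRetractFun_blockIndex, ← map_mul, ZeroHecke.pi_idem]

theorem blockRetractFun_braid (i j : Fin (n - 1)) (h : (i : ℕ) + 1 = j) :
    blockRetractFun F α i * blockRetractFun F α j * blockRetractFun F α i =
      blockRetractFun F α j * blockRetractFun F α i * blockRetractFun F α j := by
  by_cases hi : (i : ℕ) + 1 ∈ descentSet α
  · simp [blockRetractFun_of_mem F α hi, blockRetractFun_idem]
  by_cases hj : (j : ℕ) + 1 ∈ descentSet α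
  · simp [blockRetractFun_of_mem F α hj, blockRetractFun_idem]
  obtain ⟨r, p, rfl⟩ := exists_blockIndex_eq α hi
  obtain ⟨s, q, rfl⟩ := exists_blockIndex_eq α hj
  -- Adjacent generators share the letter between them, so if neither is at a descent they belong to
  -- the same block.
  have hrs : r = s := by
    rw [← index_letter_blockIndex α r p, ← index_letter_blockIndex α s q,
      ← α.index_nextLetter_of_notMem hi]
    congr 1
    ext
    exact h
  subst hrs
  simp only [blockRetractFun_blockIndex, ← map_mul]
  rw [ZeroHecke.pi_braid]
  simp only [blockIndex] at h
  omega

theorem blockRetractFun_comm (i j : Fin (n - 1)) (h : (i : ℕ) + 1 < j) :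
    blockRetractFun F α i * blockRetractFun F α j =
      blockRetractFun F α j * blockRetractFun F α i := by
  by_cases hi : (i : ℕ) + 1 ∈ descentSet α
  · simp [blockRetractFun_of_mem F α hi]
  by_cases hj : (j : ℕ) + 1 ∈ descentSet α
  · simp [blockRetractFun_of_mem F α hj]
  obtain ⟨r, p, rfl⟩ := exists_blockIndex_eq α hi
  obtain ⟨s, q, rfl⟩ := exists_blockIndex_eq α hj
  rw [blockRetractFun_blockIndex, blockRetractFun_blockIndex]
  by_cases hrs : r = s
  · subst hrs
    simp only [← map_mul]
    rw [ZeroHecke.pi_comm]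
    simp only [blockIndex] at h
    omega
  · exact commute_singleAlgHom F α hrs _ _

/-- The retraction of `H_n(0)` that sends `π_d` to `1` if `d` is in the descent set of `α`. -/
def blockRetract : ZeroHecke F n →ₐ[F] BlockTensor F α :=
  ZeroHecke.lift (blockRetractFun F α) (blockRetractFun_idem F α) (blockRetractFun_braid F α)
    (blockRetractFun_comm F α)

/-- It suffices to compare the generators of each factor. This left inverse yields injectivity of
`blockTensorHom` without a basis of `H_n(0)`. -/
theorem blockRetract_comp_blockTensorHom :
    (blockRetract F α).comp (blockTensorHom F α) = AlgHom.id F _ := by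
  refine PiTensorProduct.algHom_ext fun r => ZeroHecke.algHom_ext fun p => ?_
  simp only [AlgHom.comp_apply, blockTensorHom_single, blockHom_pi, blockRetract,
    ZeroHecke.lift_pi, blockRetractFun_blockIndex, AlgHom.id_apply]

theorem blockHom_mem_parabolic (r : Fin α.length) (x : ZeroHecke F (α.blocksFun r)) :
    blockHom F α r x ∈ parabolic F α := by
  induction x using ZeroHecke.induction with
  | algebraMap c => rw [AlgHom.commutes]; exact Subalgebra.algebraMap_mem _ c
  | add a b ha hb => rw [map_add]; exact Subalgebra.add_mem _ ha hb
  | mul a b ha hb => rw [map_mul]; exact Subalgebra.mul_mem _ ha hb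
  | piBar p =>
    rw [blockHom_piBar]
    exact Algebra.subset_adjoin ⟨_, blockIndex_notMem_descentSet α r p, rfl⟩

theorem range_blockTensorHom : (blockTensorHom F α).range = parabolic F α := by
  apply le_antisymm
  · rintro _ ⟨x, rfl⟩
    change blockTensorHom F α x ∈ _
    induction x using PiTensorProduct.induction_on with
    | smul_tprod c x =>
      rw [map_smul, blockTensorHom_tprod, blockMonoidHom_apply]
      refine Subalgebra.smul_mem _ (Subalgebra.list_prod_mem _ fun y hy => ?_) _
      obtain ⟨r, rfl⟩ := (List.mem_ofFn' _ _).1 hy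
      exact blockHom_mem_parabolic F α r (x r)
    | add x y hx hy => rw [map_add]; exact Subalgebra.add_mem _ hx hy
  · refine Algebra.adjoin_le ?_
    rintro _ ⟨i, hi, rfl⟩
    obtain ⟨r, p, rfl⟩ := exists_blockIndex_eq α hi
    exact ⟨PiTensorProduct.singleAlgHom r (ZeroHecke.piBar F p),
      (blockTensorHom_single F α r _).trans (blockHom_piBar F α r p)⟩

/-- The isomorphism of `H_α(0)` with `H_{α₁}(0) ⊗ ⋯ ⊗ H_{α_ℓ}(0)`. -/
def parabolicEquiv : parabolic F α ≃ₐ[F] BlockTensor F α :=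
  ((AlgEquiv.ofLeftInverse
      (fun x => DFunLike.congr_fun (blockRetract_comp_blockTensorHom F α) x)).trans
    (Subalgebra.equivOfEq _ _ (range_blockTensorHom F α))).symm

theorem parabolicEquiv_symm (x : BlockTensor F α) :
    (((parabolicEquiv F α).symm x : parabolic F α) : ZeroHecke F n) = blockTensorHom F α x :=
  rfl

theorem parabolicEquiv_symm_single (r : Fin α.length) (p : Fin (α.blocksFun r - 1)) :
    (((parabolicEquiv F α).symm (PiTensorProduct.singleAlgHom r (ZeroHecke.piBar F p)) :
      parabolic F α) : ZeroHecke F n) = ZeroHecke.piBar F (blockIndex α r p) := by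
  rw [parabolicEquiv_symm, blockTensorHom_single, blockHom_piBar]

end Parabolic

/-! ## Linear maps between modules of the 0-Hecke algebra -/

section LinearMaps

variable {F : Type*} [Field F] {n : ℕ} {X Y : Type*}
  [AddCommGroup X] [Module F X] [Module (ZeroHecke F n) X] [IsScalarTower F (ZeroHecke F n) X]
  [AddCommGroup Y] [Module F Y] [Module (ZeroHecke F n) Y] [IsScalarTower F (ZeroHecke F n) Y]

/-- An `F`-linear map that commutes with the generators is `H_n(0)`-linear. -/
def ZeroHecke.linearMap (f : X →ₗ[F] Y)
    (h : ∀ (i : Fin (n - 1)) x, f (piBar F i • x) = piBar F i • f x) : X →ₗ[ZeroHecke F n] Y where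
  toFun := f
  map_add' := map_add f
  map_smul' a := by
    induction a using ZeroHecke.induction with
    | algebraMap c => intro x; simp [algebraMap_smul]
    | piBar i => exact h i
    | add a b ha hb => intro x; simp [add_smul, ha, hb]
    | mul a b ha hb => intro x; simp_all [mul_smul]

@[simp]
theorem ZeroHecke.linearMap_apply (f : X →ₗ[F] Y) (h) (x : X) :
    ZeroHecke.linearMap (n := n) f h x = f x := rfl

namespace RibbonModule

variable {R : GeneralizedRibbon n}

instance : IsScalarTower F (ZeroHecke F n) (RibbonModule F R) where
  smul_assoc c a v := by
    change rep F R (c • a) v = c • rep F R a v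
    rw [map_smul, LinearMap.smul_apply]

theorem piBar_smul_higher {i : Fin (n - 1)} {τ : StandardTableau R}
    (h : τ.row (nextLetter i) < τ.row (letter i)) :
    ZeroHecke.piBar F i • single F τ = - single F τ := by
  rw [piBar_smul_single, ← piBarEnd_single, piBarEnd_higher F h]

theorem piBar_smul_same {i : Fin (n - 1)} {τ : StandardTableau R}
    (h : τ.row (letter i) = τ.row (nextLetter i)) :
    ZeroHecke.piBar F i • single F τ = 0 := by
  rw [piBar_smul_single, ← piBarEnd_single, piBarEnd_same F h]

theorem piBar_smul_lower {i : Fin (n - 1)} {τ : StandardTableau R}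
    (h : τ.row (letter i) < τ.row (nextLetter i)) :
    ZeroHecke.piBar F i • single F τ = single F (τ.swap i h) := by
  rw [piBar_smul_single, ← piBarEnd_single, piBarEnd_lower F h]

variable (F) in
/-- The `F`-linear map given by the images of the tableaux. -/
def liftₗ (g : StandardTableau R → X) : RibbonModule F R →ₗ[F] X :=
  Finsupp.linearCombination F g

omit [Module (ZeroHecke F n) X] [IsScalarTower F (ZeroHecke F n) X] in
@[simp]
theorem liftₗ_single (g : StandardTableau R → X) (τ : StandardTableau R) :
    liftₗ F g (single F τ) = g τ :=
  (Finsupp.linearCombination_single F (1 : F) τ).trans (one_smul F _)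

@[elab_as_elim]
theorem induction {P : RibbonModule F R → Prop} (zero : P 0)
    (add : ∀ v w, P v → P w → P (v + w)) (smul : ∀ (c : F) v, P v → P (c • v))
    (single : ∀ τ, P (single F τ)) (v : RibbonModule F R) : P v := by
  refine Finsupp.induction_linear v zero add fun τ c => ?_
  have h : Finsupp.single τ c = (c • RibbonModule.single F τ : RibbonModule F R) := by
    refine Eq.trans ?_ (Finsupp.smul_single c τ (1 : F)).symm
    simp
  rw [h]
  exact smul c _ (single τ)

/-- The `H_n(0)`-linear map given by the images of the tableaux. -/
def lift (g : StandardTableau R → X)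
    (higher : ∀ (i : Fin (n - 1)) (τ : StandardTableau R), τ.row (nextLetter i) < τ.row (letter i) →
      ZeroHecke.piBar F i • g τ = - g τ)
    (same : ∀ (i : Fin (n - 1)) (τ : StandardTableau R), τ.row (letter i) = τ.row (nextLetter i) →
      ZeroHecke.piBar F i • g τ = 0)
    (lower : ∀ (i : Fin (n - 1)) (τ : StandardTableau R)
      (h : τ.row (letter i) < τ.row (nextLetter i)), ZeroHecke.piBar F i • g τ = g (τ.swap i h)) :
    RibbonModule F R →ₗ[ZeroHecke F n] X :=
  ZeroHecke.linearMap (liftₗ F g) fun i v => by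
    induction v using RibbonModule.induction with
    | zero => simp
    | add v w hv hw => rw [smul_add, map_add, hv, hw, map_add, smul_add]
    | smul c v hv => rw [smul_comm, map_smul, hv, map_smul, smul_comm]
    | single τ =>
      rcases lt_trichotomy (τ.row (letter i)) (τ.row (nextLetter i)) with h | h | h
      · rw [piBar_smul_lower h, liftₗ_single, liftₗ_single, lower i τ h]
      · rw [piBar_smul_same h, liftₗ_single, same i τ h, map_zero]
      · rw [piBar_smul_higher h, map_neg, liftₗ_single, higher i τ h]

@[simp]
theorem lift_single (g : StandardTableau R → X) (higher same lower) (τ : StandardTableau R) :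
    lift (F := F) g higher same lower (single F τ) = g τ := by
  simp [lift]

end RibbonModule

end LinearMaps

/-! ## Tableaux as permutations -/

namespace GeneralizedRibbon

variable {n : ℕ}

theorem sum_Iio_succ {L : ℕ} (f : Fin L → ℕ) {k : ℕ} (h : k + 1 < L) :
    ∑ q ∈ Finset.Iio (⟨k + 1, h⟩ : Fin L), f q =
      ∑ q ∈ Finset.Iio (⟨k, by omega⟩ : Fin L), f q + f ⟨k, by omega⟩ := by
  have : Finset.Iio (⟨k + 1, h⟩ : Fin L) =
      insert ⟨k, by omega⟩ (Finset.Iio (⟨k, by omega⟩ : Fin L)) := by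
    ext x; simp only [Finset.mem_Iio, Finset.mem_insert, Fin.lt_def, Fin.ext_iff]; omega
  rw [this, Finset.sum_insert (by simp), add_comm]

theorem sum_Iio_zero {L : ℕ} (f : Fin L → ℕ) (h : 0 < L) :
    ∑ q ∈ Finset.Iio (⟨0, h⟩ : Fin L), f q = 0 :=
  Finset.sum_eq_zero fun _ hx => absurd (Finset.mem_Iio.1 hx) (by simp [Fin.lt_def])

theorem startCol_rowSum (α : Composition n) (r : Fin α.length) :
    (rowSum α).startCol r = α.sizeUpTo r := by
  change ∑ q ∈ Finset.Iio r, (α.blocksFun q - 0) = _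
  obtain ⟨k, hk⟩ := r
  induction k with
  | zero => simp [sum_Iio_zero]
  | succ k ih =>
    have h1 := α.sizeUpTo_succ' ⟨k, by omega⟩
    have h2 := ih (by omega)
    simp only at h1 h2
    rw [sum_Iio_succ, h2, h1, Nat.sub_zero]

theorem startCol_ribbon (α : Composition n) (r : Fin α.length) :
    (ribbon α).startCol r + r = α.sizeUpTo r := by
  change ∑ q ∈ Finset.Iio r, (α.blocksFun q - 1) + _ = _
  obtain ⟨k, hk⟩ := r
  induction k with
  | zero => simp [sum_Iio_zero]
  | succ k ih =>
    have h1 := α.sizeUpTo_succ' ⟨k, by omega⟩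
    have h2 := α.one_le_blocksFun ⟨k, by omega⟩
    have h3 := ih (by omega)
    simp only at h1 h2 h3
    rw [sum_Iio_succ]
    simp only
    omega

/-- The position of a box, where boxes are read row by row from bottom to top. -/
def position (R : GeneralizedRibbon n) : R.Box ≃ Fin n := R.rows.blocksFinEquiv

theorem coe_position (R : GeneralizedRibbon n) (b : R.Box) :
    (R.position b : ℕ) = R.rows.sizeUpTo b.1 + b.2 := rfl

theorem index_position (R : GeneralizedRibbon n) (b : R.Box) :
    R.rows.index (R.position b) = b.1 := R.rows.index_embedding b.1 b.2

theorem col_lt_iff (R : GeneralizedRibbon n) {b c : R.Box} (h : b.1 = c.1) :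
    R.col b < R.col c ↔ R.position b < R.position c := by
  obtain ⟨r, k⟩ := b
  obtain ⟨r', k'⟩ := c
  obtain rfl : r = r' := h
  rw [Fin.lt_def, coe_position, coe_position, col, col]
  simp

theorem col_rowSum (α : Composition n) (b : (rowSum α).Box) :
    (rowSum α).col b = (rowSum α).position b := by
  exact congrArg (· + (b.2 : ℕ)) (startCol_rowSum α b.1)

/-- Each new row of a ribbon starts in the last column of the row below, so every row passed costs
one column. -/
theorem col_ribbon (α : Composition n) (b : (ribbon α).Box) :
    (ribbon α).col b + b.1 = (ribbon α).position b := by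
  have := startCol_ribbon α b.1
  rw [col, coe_position]
  simp only [ribbon] at *
  omega

end GeneralizedRibbon

theorem Fin.perm_eq_one_of_strictMono {n : ℕ} {w : Equiv.Perm (Fin n)} (h : StrictMono w) :
    w = 1 := by
  have : h.orderIsoOfSurjective w w.surjective = OrderIso.refl _ := Subsingleton.elim _ _
  ext x
  exact congrArg Fin.val (DFunLike.congr_fun this x)

namespace StandardTableau

open GeneralizedRibbon

variable {n : ℕ} {R : GeneralizedRibbon n}

/-- The reading word of a tableau, a permutation of the letters. -/
def perm (τ : StandardTableau R) : Equiv.Perm (Fin n) := R.position.symm.trans τ.entry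

theorem perm_position (τ : StandardTableau R) (b : R.Box) : τ.perm (R.position b) = τ.entry b := by
  simp [perm]

theorem perm_injective : Function.Injective (perm : StandardTableau R → _) := by
  intro τ σ h
  refine StandardTableau.ext (Equiv.ext fun b => ?_)
  rw [← perm_position, ← perm_position, h]

theorem row_perm (τ : StandardTableau R) (p : Fin n) : τ.row (τ.perm p) = R.rows.index p := by
  obtain ⟨b, rfl⟩ := R.position.surjective p
  rw [perm_position, row_entry, index_position]

theorem row_eq (τ : StandardTableau R) (x : Fin n) : τ.row x = R.rows.index (τ.perm.symm x) := by
  rw [← row_perm, Equiv.apply_symm_apply]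

theorem perm_lt (τ : StandardTableau R) {p q : Fin n} (h : R.rows.index p = R.rows.index q)
    (hpq : p < q) : τ.perm p < τ.perm q := by
  obtain ⟨b, rfl⟩ := R.position.surjective p
  obtain ⟨c, rfl⟩ := R.position.surjective q
  rw [index_position, index_position] at h
  rw [perm_position, perm_position]
  exact τ.row_lt b c h ((R.col_lt_iff h).2 hpq)

theorem perm_symm_lt (τ : StandardTableau R) {x y : Fin n} (h : τ.row x = τ.row y)
    (hxy : x < y) : τ.perm.symm x < τ.perm.symm y := by
  rw [row_eq, row_eq] at h
  by_contra h'
  rcases (not_lt.1 h').lt_or_eq with h' | h'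
  · have := τ.perm_lt h.symm h'
    simp only [Equiv.apply_symm_apply] at this
    exact lt_asymm this hxy
  · exact hxy.ne' (τ.perm.symm.injective h')

theorem perm_symm_lt_of_row_lt (τ : StandardTableau R) {x y : Fin n} (h : τ.row x < τ.row y) :
    τ.perm.symm x < τ.perm.symm y := by
  rw [row_eq, row_eq] at h
  by_contra h'
  exact absurd (R.rows.index_monotone (not_lt.1 h')) (not_le.2 h)

/-- The tableau with a given reading word. -/
def ofPerm (w : Equiv.Perm (Fin n))
    (hrow : ∀ p q, R.rows.index p = R.rows.index q → p < q → w p < w q)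
    (hcol : ∀ b c : R.Box, R.col b = R.col c → b.1 < c.1 → w (R.position c) < w (R.position b)) :
    StandardTableau R where
  entry := R.position.trans w
  row_lt b c hbc h := hrow _ _ (by rw [index_position, index_position, hbc])
    ((R.col_lt_iff hbc).1 h)
  col_lt := hcol

theorem perm_ofPerm (w : Equiv.Perm (Fin n)) (hrow) (hcol) :
    (ofPerm (R := R) w hrow hcol).perm = w := by
  ext; simp [perm, ofPerm]

/-! ### Tableaux with one-row components -/

section RowSum

variable {α : Composition n}

/-- Column and position coincide here, so distinct boxes have distinct columns and the column
condition is vacuous. -/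
theorem rowSum_col_ne {b c : (rowSum α).Box} (h : (rowSum α).col b = (rowSum α).col c) :
    ¬ b.1 < c.1 := by
  rw [col_rowSum, col_rowSum, ← Fin.ext_iff] at h
  rw [(rowSum α).position.injective h]
  exact lt_irrefl _

/-- The tableau of shape `α₁ ⊕ ⋯ ⊕ α_ℓ` with a given reading word. -/
def rowSumOfPerm (w : Equiv.Perm (Fin n))
    (h : ∀ p q, α.index p = α.index q → p < q → w p < w q) : StandardTableau (rowSum α) :=
  ofPerm w h fun _ _ h h' => absurd h' (rowSum_col_ne h)

theorem perm_rowSumOfPerm (w : Equiv.Perm (Fin n)) (h) :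
    (rowSumOfPerm (α := α) w h).perm = w := perm_ofPerm w _ _

/-- Rows are sorted, so a tableau is determined by which letters each row contains: the permutation
comparing the two reading words is strictly increasing, hence trivial. -/
theorem row_injective {τ σ : StandardTableau (rowSum α)} (h : ∀ x, τ.row x = σ.row x) :
    τ = σ := by
  have h1 : StrictMono (τ.perm.trans σ.perm.symm) := by
    intro p q hpq
    rw [Equiv.trans_apply, Equiv.trans_apply]
    rcases (α.index_monotone hpq.le).lt_or_eq with h' | h'
    · apply perm_symm_lt_of_row_lt
      rwa [← h, ← h, row_perm, row_perm]
    · apply perm_symm_lt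
      · rw [← h, ← h, row_perm, row_perm]; exact h'
      · exact τ.perm_lt h' hpq
  have h2 := Fin.perm_eq_one_of_strictMono h1
  apply perm_injective
  ext p
  have := DFunLike.congr_fun h2 p
  rw [Equiv.trans_apply, Equiv.symm_apply_eq] at this
  rw [this]; rfl

variable (α) in
/-- The tableau with reading word `1, …, n`. -/
def rowSumBase : StandardTableau (rowSum α) := rowSumOfPerm 1 fun _ _ _ h => h

theorem row_rowSumBase (x : Fin n) : (rowSumBase α).row x = α.index x := by
  have h : (rowSumBase α).perm = 1 := perm_rowSumOfPerm _ _
  rw [row_eq, h]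
  rfl

open Classical in
/-- The tableau obtained by exchanging the letters `i` and `i + 1` if they are in different rows. -/
def act (i : Fin (n - 1)) (τ : StandardTableau (rowSum α)) : StandardTableau (rowSum α) :=
  if h : τ.row (letter i) = τ.row (nextLetter i) then τ else
  { entry := τ.entry.trans (Equiv.swap (letter i) (nextLetter i))
    row_lt := fun b c hbc hc => by
      refine swap_lt_swap i (τ.row_lt b c hbc hc) ?_
      rintro ⟨h1, h2⟩
      rw [← h1, ← h2, row_entry, row_entry, hbc] at h
      exact h rfl
    col_lt := fun _ _ h h' => absurd h' (rowSum_col_ne h) }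

theorem row_act (i : Fin (n - 1)) (τ : StandardTableau (rowSum α)) (x : Fin n) :
    (act i τ).row x = τ.row (Equiv.swap (letter i) (nextLetter i) x) := by
  unfold act
  split_ifs with h
  · by_cases h1 : x = letter i
    · rw [h1, Equiv.swap_apply_left, h]
    by_cases h2 : x = nextLetter i
    · rw [h2, Equiv.swap_apply_right, h]
    rw [Equiv.swap_apply_of_ne_of_ne h1 h2]
  · simp [row]

theorem swap_eq_act (i : Fin (n - 1)) (τ : StandardTableau (rowSum α))
    (h : τ.row (letter i) < τ.row (nextLetter i)) : τ.swap i h = act i τ :=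
  row_injective fun x => by rw [row_swap, row_act]

theorem row_act_letter (i : Fin (n - 1)) (τ : StandardTableau (rowSum α)) :
    (act i τ).row (letter i) = τ.row (nextLetter i) := by
  rw [row_act, Equiv.swap_apply_left]

theorem row_act_nextLetter (i : Fin (n - 1)) (τ : StandardTableau (rowSum α)) :
    (act i τ).row (nextLetter i) = τ.row (letter i) := by
  rw [row_act, Equiv.swap_apply_right]

theorem row_act_of_ne (i : Fin (n - 1)) (τ : StandardTableau (rowSum α)) {x : Fin n}
    (h1 : (x : ℕ) ≠ i) (h2 : (x : ℕ) ≠ i + 1) : (act i τ).row x = τ.row x := by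
  rw [row_act, Equiv.swap_apply_of_ne_of_ne]
  · exact fun h => h1 (congrArg Fin.val h)
  · exact fun h => h2 (congrArg Fin.val h)

theorem act_act (i : Fin (n - 1)) (τ : StandardTableau (rowSum α)) : act i (act i τ) = τ :=
  row_injective fun x => by rw [row_act, row_act, Equiv.swap_apply_self]

theorem act_comm {i j : Fin (n - 1)} (h : (i : ℕ) + 1 < j) (τ : StandardTableau (rowSum α)) :
    act i (act j τ) = act j (act i τ) := by
  refine row_injective fun x => ?_
  simp only [row_act]
  congr 1
  simp only [Equiv.swap_apply_def, letter, nextLetter, Fin.ext_iff]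
  grind

theorem act_braid {i j : Fin (n - 1)} (h : (i : ℕ) + 1 = j) (τ : StandardTableau (rowSum α)) :
    act i (act j (act i τ)) = act j (act i (act j τ)) := by
  refine row_injective fun x => ?_
  simp only [row_act]
  congr 1
  simp only [Equiv.swap_apply_def, letter, nextLetter, Fin.ext_iff]
  grind

/-- The word of the rows of the letters, in the lexicographic order. -/
def rowWord (τ : StandardTableau (rowSum α)) : Lex (Fin n → Fin α.length) :=
  toLex fun x => τ.row x

/-- The first entry that changes is the one at `i`, and it drops. This makes sorting along descents
terminate. -/
theorem rowWord_act_lt {i : Fin (n - 1)} {τ : StandardTableau (rowSum α)}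
    (h : τ.row (nextLetter i) < τ.row (letter i)) : rowWord (act i τ) < rowWord τ := by
  refine ⟨letter i, fun x hx => ?_, ?_⟩
  · have hx' : (x : ℕ) < i := hx
    exact row_act_of_ne i τ (by omega) (by omega)
  · change (act i τ).row _ < τ.row _
    rwa [row_act_letter]

theorem eq_rowSumBase {τ : StandardTableau (rowSum α)}
    (h : ∀ i : Fin (n - 1), τ.row (letter i) ≤ τ.row (nextLetter i)) : τ = rowSumBase α := by
  have h1 : Monotone τ.row := by
    intro x y hxy
    obtain ⟨x, hx⟩ := x
    obtain ⟨y, hy⟩ := y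
    have hxy : x ≤ y := hxy
    induction y, hxy using Nat.le_induction with
    | base => exact le_rfl
    | succ y hxy ih => exact (ih (by omega) ‹_›).trans (h ⟨y, by omega⟩)
  have h2 : StrictMono τ.perm.symm := by
    intro x y hxy
    rcases (h1 hxy.le).lt_or_eq with h' | h'
    · exact τ.perm_symm_lt_of_row_lt h'
    · exact τ.perm_symm_lt h' hxy
  have h3 := Fin.perm_eq_one_of_strictMono h2
  refine row_injective fun x => ?_
  rw [row_eq, h3, row_rowSumBase]; rfl

end RowSum

end StandardTableau

/-! ## The universal property of `M_α` -/

namespace RowSumModule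

open GeneralizedRibbon StandardTableau ZeroHecke RibbonModule

variable {F : Type*} [Field F] {n : ℕ} {α : Composition n} {X : Type*}
  [AddCommGroup X] [Module F X] [Module (ZeroHecke F n) X] [IsScalarTower F (ZeroHecke F n) X]

variable (F) in
open Classical in
/-- The image of a tableau under the homomorphism that sends the base tableau to `x`. -/
def orbit (x : X) (τ : StandardTableau (rowSum α)) : X :=
  if h : ∃ i : Fin (n - 1), τ.row (nextLetter i) < τ.row (letter i) then
    piBar F h.choose • orbit x (act h.choose τ)
  else x
termination_by wellFounded_lt.wrap (rowWord τ)
decreasing_by exact rowWord_act_lt h.choose_spec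

omit [Module F X] [IsScalarTower F (ZeroHecke F n) X] in
theorem orbit_rowSumBase (x : X) : orbit F x (rowSumBase α) = x := by
  rw [orbit, dif_neg]
  rintro ⟨i, hi⟩
  rw [row_rowSumBase, row_rowSumBase] at hi
  exact absurd (α.index_monotone (show letter i ≤ nextLetter i by
    simp [Fin.le_def, letter, nextLetter])) (not_le.2 hi)

theorem nextLetter_eq_letter {i j : Fin (n - 1)} (h : (i : ℕ) + 1 = j) :
    nextLetter i = letter j := Fin.ext h

omit [Module F X] [IsScalarTower F (ZeroHecke F n) X] in
-- The definition of `orbit` picks an arbitrary descent; the first claim says that every descent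
-- gives the same vector. Both claims are proved together by induction on the row word, as each uses
-- the first for smaller words.
theorem orbit_spec {x : X} (hx : ∀ i : Fin (n - 1), (i : ℕ) + 1 ∉ descentSet α → piBar F i • x = 0)
    (τ : StandardTableau (rowSum α)) :
    (∀ i : Fin (n - 1), τ.row (nextLetter i) < τ.row (letter i) →
      orbit F x τ = piBar F i • orbit F x (act i τ)) ∧
    (∀ i : Fin (n - 1), τ.row (letter i) = τ.row (nextLetter i) →
      piBar F i • orbit F x τ = 0) := by
  induction hw : rowWord τ using WellFoundedLT.induction generalizing τ with
  | ind w ih =>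
  subst hw
  have far {i j : Fin (n - 1)} (h : (i : ℕ) + 1 < j ∨ (j : ℕ) + 1 < i) (σ : StandardTableau (rowSum α)) :
      (act i σ).row (letter j) = σ.row (letter j) ∧
      (act i σ).row (nextLetter j) = σ.row (nextLetter j) :=
    ⟨row_act_of_ne i σ (by simp [letter]; omega) (by simp [letter]; omega),
      row_act_of_ne i σ (by simp [nextLetter]; omega) (by simp [nextLetter]; omega)⟩
  have near {i j : Fin (n - 1)} (h : (i : ℕ) + 1 = j) (σ : StandardTableau (rowSum α)) :
      (act i σ).row (nextLetter j) = σ.row (nextLetter j) :=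
    row_act_of_ne i σ (by simp [nextLetter]; omega) (by simp [nextLetter]; omega)
  have near' {i j : Fin (n - 1)} (h : (i : ℕ) + 1 = j) (σ : StandardTableau (rowSum α)) :
      (act j σ).row (letter i) = σ.row (letter i) :=
    row_act_of_ne j σ (by simp [letter]; omega) (by simp [letter]; omega)
  have step {σ : StandardTableau (rowSum α)} (hσ : rowWord σ < rowWord τ) {i : Fin (n - 1)}
      (h : σ.row (nextLetter i) < σ.row (letter i)) :
      orbit F x σ = piBar F i • orbit F x (act i σ) := (ih _ hσ σ rfl).1 i h
  -- Both sides are rewritten down to a common smaller tableau. Distant descents meet after one more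
  -- step; adjacent ones mean three letters in strictly decreasing rows, and the two ways of sorting
  -- them are the two sides of the braid relation.
  have diamond : ∀ i j : Fin (n - 1), i < j → τ.row (nextLetter i) < τ.row (letter i) →
      τ.row (nextLetter j) < τ.row (letter j) →
      piBar F i • orbit F x (act i τ) = piBar F j • orbit F x (act j τ) := by
    intro i j hij hi hj
    have hij' : (i : ℕ) + 1 ≤ j := hij
    have hi' := rowWord_act_lt hi
    have hj' := rowWord_act_lt hj
    rcases hij'.lt_or_eq with h | h
    · have f1 := far (Or.inl h) τ
      have f2 := far (Or.inr h) τ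
      rw [step hi' (i := j) (by rwa [f1.1, f1.2]), step hj' (i := i) (by rwa [f2.1, f2.2]),
        smul_smul, smul_smul, piBar_comm F h, act_comm h]
    · have e := nextLetter_eq_letter h
      have a1 : (act i τ).row (nextLetter j) < (act i τ).row (letter j) := by
        rw [near h, ← e, row_act_nextLetter]
        rw [← e] at hj
        exact hj.trans hi
      have a2 : (act j (act i τ)).row (nextLetter i) < (act j (act i τ)).row (letter i) := by
        rw [near' h, e, row_act_letter, near h, row_act_letter, e]
        exact hj
      have b1 : (act j τ).row (nextLetter i) < (act j τ).row (letter i) := by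
        rw [near' h, e, row_act_letter]
        rw [← e] at hj
        exact hj.trans hi
      have b2 : (act i (act j τ)).row (nextLetter j) < (act i (act j τ)).row (letter j) := by
        rw [near h, ← e, row_act_nextLetter, row_act_nextLetter, near' h, ← e]
        exact hi
      rw [step hi' a1, step ((rowWord_act_lt a1).trans hi') a2, step hj' b1,
        step ((rowWord_act_lt b1).trans hj') b2, act_braid h]
      simp only [smul_smul, ← mul_assoc]
      rw [piBar_braid F h]
  have first : ∀ i : Fin (n - 1), τ.row (nextLetter i) < τ.row (letter i) →
      orbit F x τ = piBar F i • orbit F x (act i τ) := by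
    intro i hi
    have h : ∃ i : Fin (n - 1), τ.row (nextLetter i) < τ.row (letter i) := ⟨i, hi⟩
    rw [orbit, dif_pos h]
    rcases lt_trichotomy i h.choose with h' | h' | h'
    · exact (diamond _ _ h' hi h.choose_spec).symm
    · rw [← h']
    · exact diamond _ _ h' h.choose_spec hi
  refine ⟨first, fun i hi => ?_⟩
  -- Remove a descent `j`, which differs from `i`, and move `π̄_i` past it to a smaller tableau
  -- where the induction hypothesis kills it. With no descent left the tableau is the base, and the
  -- hypothesis on `x` applies.
  by_cases h : ∃ j : Fin (n - 1), τ.row (nextLetter j) < τ.row (letter j)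
  · obtain ⟨j, hj⟩ := h
    have hj' := rowWord_act_lt hj
    rw [first j hj]
    rcases lt_trichotomy i j with hij | hij | hij
    · have hij' : (i : ℕ) + 1 ≤ j := hij
      rcases hij'.lt_or_eq with h | h
      · have f := far (Or.inr h) τ
        rw [smul_smul, piBar_comm F h, ← smul_smul,
          (ih _ hj' _ rfl).2 i (by rw [f.1, f.2, hi]), smul_zero]
      · have e := nextLetter_eq_letter h
        have b1 : (act j τ).row (nextLetter i) < (act j τ).row (letter i) := by
          rw [near' h, e, row_act_letter, hi, e]
          exact hj
        -- The rows of the three letters are `r, r, s` with `s < r`. Sorting along `j`, then `i`,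
        -- gives `s, r, r`; the braid relation turns `π̄_i π̄_j π̄_i` into `π̄_j π̄_i π̄_j`, and the
        -- inner `π̄_j` vanishes on the pair `r, r`.
        rw [step hj' b1, smul_smul, smul_smul, piBar_braid F h, ← smul_smul,
          (ih _ ((rowWord_act_lt b1).trans hj') _ rfl).2 j, smul_zero]
        rw [near h, ← e, row_act_nextLetter, near' h, row_act_nextLetter, hi, e]
    · rw [hij] at hi; exact absurd hi hj.ne'
    · have hij' : (j : ℕ) + 1 ≤ i := hij
      rcases hij'.lt_or_eq with h | h
      · have f := far (Or.inl h) τ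
        rw [smul_smul, ← piBar_comm F h, ← smul_smul,
          (ih _ hj' _ rfl).2 i (by rw [f.1, f.2, hi]), smul_zero]
      · have e := nextLetter_eq_letter h
        have b1 : (act j τ).row (nextLetter i) < (act j τ).row (letter i) := by
          rw [near h, ← e, row_act_nextLetter, ← hi, ← e]
          exact hj
        rw [step hj' b1, smul_smul, smul_smul, ← piBar_braid F h, ← smul_smul,
          (ih _ ((rowWord_act_lt b1).trans hj') _ rfl).2 j, smul_zero]
        rw [near' h, row_act_letter, e, row_act_letter, near h, ← hi]
  · push Not at h
    rw [eq_rowSumBase h] at hi ⊢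
    rw [orbit_rowSumBase]
    rw [row_rowSumBase, row_rowSumBase] at hi
    exact hx i (α.index_nextLetter_eq_iff.1 hi)

/-- The homomorphism on `M_α` that sends the base tableau to a vector `x` killed by the parabolic
generators. -/
def desc (x : X) (hx : ∀ i : Fin (n - 1), (i : ℕ) + 1 ∉ descentSet α → piBar F i • x = 0) :
    RibbonModule F (rowSum α) →ₗ[ZeroHecke F n] X :=
  RibbonModule.lift (orbit F x)
    (fun i τ h => by rw [(orbit_spec hx τ).1 i h, smul_smul, piBar_sq, neg_smul])
    (fun i τ h => (orbit_spec hx τ).2 i h)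
    -- After the exchange `i` is a descent, so `orbit_spec` applied to `act i τ` leads back to `τ`.
    (fun i τ h => by
      rw [swap_eq_act, (orbit_spec hx (act i τ)).1 i, act_act]
      rwa [row_act_letter, row_act_nextLetter])

theorem desc_rowSumBase (x : X) (hx) :
    desc (F := F) (α := α) x hx (single F (rowSumBase α)) = x := by
  rw [desc, lift_single, orbit_rowSumBase]

theorem piBar_smul_rowSumBase {i : Fin (n - 1)} (hi : (i : ℕ) + 1 ∉ descentSet α) :
    piBar F i • single F (rowSumBase α) = 0 := by
  refine piBar_smul_same ?_
  rw [row_rowSumBase, row_rowSumBase]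
  exact α.index_nextLetter_eq_iff.2 hi

omit [Module F X] [IsScalarTower F (ZeroHecke F n) X] in
-- The base tableau generates: any other tableau has a descent `i`, and is then `π̄_i` applied to a
-- tableau with smaller row word.
theorem hom_ext {f g : RibbonModule F (rowSum α) →ₗ[ZeroHecke F n] X}
    (h : f (single F (rowSumBase α)) = g (single F (rowSumBase α))) : f = g := by
  refine LinearMap.ext fun v => ?_
  induction v using RibbonModule.induction with
  | zero => simp
  | add v w hv hw => rw [map_add, map_add, hv, hw]
  | smul c v hv => rw [← algebraMap_smul (ZeroHecke F n), map_smul, map_smul, hv]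
  | single τ =>
    induction hw : rowWord τ using WellFoundedLT.induction generalizing τ with
    | ind w ih =>
    subst hw
    by_cases h' : ∃ i : Fin (n - 1), τ.row (nextLetter i) < τ.row (letter i)
    · obtain ⟨i, hi⟩ := h'
      have hτ : single F τ = piBar F i • single F (act i τ) := by
        have hi' : (act i τ).row (letter i) < (act i τ).row (nextLetter i) := by
          rwa [row_act_letter, row_act_nextLetter]
        rw [piBar_smul_lower hi', swap_eq_act, act_act]
      rw [hτ, map_smul, map_smul, ih _ (rowWord_act_lt hi) _ rfl]
    · push Not at h'
      rw [eq_rowSumBase h']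
      exact h

end RowSumModule

/-! ## `M_α` as an induced module -/

namespace RowModule

open GeneralizedRibbon StandardTableau ZeroHecke RibbonModule

variable (F : Type*) [Field F]

section

variable (m : ℕ) (h : 0 < m)

instance : Subsingleton (Fin (ribbon (Composition.single m h)).rows.length) :=
  inferInstanceAs (Subsingleton (Fin 1))

instance : Subsingleton (StandardTableau (ribbon (Composition.single m h))) where
  allEq τ σ := by
    have h1 (τ : StandardTableau (ribbon (Composition.single m h))) : τ.perm = 1 :=
      Fin.perm_eq_one_of_strictMono fun _ _ hpq => τ.perm_lt (Subsingleton.elim _ _) hpq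
    exact perm_injective ((h1 τ).trans (h1 σ).symm)

/-- The unique tableau of one-row shape. -/
def tableau : StandardTableau (ribbon (Composition.single m h)) :=
  ofPerm 1 (fun _ _ _ h => h) fun _ _ _ h => absurd (Subsingleton.elim _ _) h.ne

/-- The coordinate of a vector of the one-dimensional space `P_m`. -/
def coord : RowModule F m h →ₗ[F] F := liftₗ F fun _ => 1

theorem coord_tableau : coord F m h (single F (tableau m h)) = 1 := liftₗ_single _ _

theorem coord_smul_tableau (v : RowModule F m h) : coord F m h v • single F (tableau m h) = v := by
  induction v using RibbonModule.induction with
  | zero => simp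
  | add v w hv hw => rw [map_add, add_smul, hv, hw]
  | smul c v hv => rw [map_smul, smul_assoc, hv]
  | single τ => rw [Subsingleton.elim τ (tableau m h), coord_tableau, one_smul]

theorem piBar_smul_eq_zero (i : Fin (m - 1)) (v : RowModule F m h) : piBar F i • v = 0 := by
  rw [← coord_smul_tableau F m h v, smul_comm, piBar_smul_same (Subsingleton.elim _ _), smul_zero]

end

variable {n : ℕ} (α : Composition n)

/-- The basis vector of `P_{α₁} ⊗ ⋯ ⊗ P_{α_ℓ}`. -/
def tensorBase : RowTensor F α :=
  PiTensorProduct.tprod F fun _ => single F (tableau _ _)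

/-- The coordinate of a vector of the one-dimensional space `P_{α₁} ⊗ ⋯ ⊗ P_{α_ℓ}`. -/
def tensorCoord : RowTensor F α →ₗ[F] F :=
  PiTensorProduct.lift ((MultilinearMap.mkPiAlgebra F (Fin α.length) F).compLinearMap
    fun _ => coord F _ _)

theorem tensorCoord_tensorBase : tensorCoord F α (tensorBase F α) = 1 := by
  simp [tensorCoord, tensorBase, coord_tableau]

theorem tensorCoord_smul_tensorBase (v : RowTensor F α) :
    tensorCoord F α v • tensorBase F α = v := by
  induction v using PiTensorProduct.induction_on with
  | smul_tprod c v =>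
    rw [map_smul, smul_assoc]
    congr 1
    conv_rhs => rw [← funext fun r => coord_smul_tableau F _ (α.one_le_blocksFun r) (v r)]
    rw [MultilinearMap.map_smul_univ]
    simp [tensorCoord, tensorBase]
  | add v w hv hw => rw [map_add, add_smul, hv, hw]

theorem rowTensorRep_single_piBar (r : Fin α.length) (p : Fin (α.blocksFun r - 1))
    (v : RowTensor F α) :
    rowTensorRep F α (PiTensorProduct.singleAlgHom r (piBar F p)) v = 0 := by
  rw [← tensorCoord_smul_tensorBase F α v, map_smul]
  refine (congrArg _ ?_).trans (smul_zero _)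
  refine (rowTensorRep_tprod F α _ _).trans ?_
  refine MultilinearMap.map_coord_zero _ r ?_
  simp only [MonoidHom.mulSingle_apply, Pi.mulSingle_eq_same]
  exact piBar_smul_eq_zero F _ _ p _

/-- The action of `H_α(0)` on `P_{α₁} ⊗ ⋯ ⊗ P_{α_ℓ}`. -/
abbrev parabolicRep : parabolic F α →ₐ[F] Module.End F (RowTensor F α) :=
  (rowTensorRep F α).comp (parabolicEquiv F α : parabolic F α →ₐ[F] BlockTensor F α)

theorem parabolicRep_piBar {i : Fin (n - 1)} (hi : (i : ℕ) + 1 ∉ descentSet α)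
    (h : piBar F i ∈ parabolic F α) (v : RowTensor F α) :
    parabolicRep F α ⟨piBar F i, h⟩ v = 0 := by
  obtain ⟨r, p, rfl⟩ := exists_blockIndex_eq α hi
  have : (⟨piBar F (blockIndex α r p), h⟩ : parabolic F α) =
      (parabolicEquiv F α).symm (PiTensorProduct.singleAlgHom r (piBar F p)) :=
    Subtype.ext (parabolicEquiv_symm_single F α r p).symm
  rw [this]
  exact (congrArg (fun y : BlockTensor F α => rowTensorRep F α y v)
    ((parabolicEquiv F α).apply_symm_apply _)).trans
    (rowTensorRep_single_piBar F α r p v)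

/-- The generators of `H_α(0)` kill both the base tableau and the tensor line, and having a common
eigenvalue is preserved by sums and products. This is what makes `a ⊗ v ↦ a v` balanced. -/
theorem exists_eigenvalue (b : parabolic F α) : ∃ c : F,
    (b : ZeroHecke F n) • single F (rowSumBase α) = c • single F (rowSumBase α) ∧
      ∀ v, parabolicRep F α b v = c • v := by
  obtain ⟨b, hb⟩ := b
  induction hb using Algebra.adjoin_induction with
  | mem x hx =>
    obtain ⟨i, hi, rfl⟩ := hx
    refine ⟨0, ?_, fun v => ?_⟩
    · rw [zero_smul]; exact RowSumModule.piBar_smul_rowSumBase hi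
    · rw [zero_smul]; exact parabolicRep_piBar F α hi _ v
  | algebraMap c =>
    refine ⟨c, algebraMap_smul _ _ _, fun v => ?_⟩
    change parabolicRep F α (algebraMap F _ c) v = _
    rw [AlgHom.commutes]; rfl
  | add x y hx hy ihx ihy =>
    obtain ⟨c, hc, hc'⟩ := ihx
    obtain ⟨d, hd, hd'⟩ := ihy
    refine ⟨c + d, ?_, fun v => ?_⟩
    · simp only at hc hd ⊢
      rw [add_smul, add_smul, hc, hd]
    · change parabolicRep F α (⟨x, hx⟩ + ⟨y, hy⟩) v = _
      rw [map_add, LinearMap.add_apply, hc', hd', add_smul]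
  | mul x y hx hy ihx ihy =>
    obtain ⟨c, hc, hc'⟩ := ihx
    obtain ⟨d, hd, hd'⟩ := ihy
    refine ⟨c * d, ?_, fun v => ?_⟩
    · simp only at hc hd ⊢
      rw [mul_smul, hd, smul_comm, hc, smul_smul, mul_comm]
    · change parabolicRep F α (⟨x, hx⟩ * ⟨y, hy⟩) v = _
      rw [map_mul, Module.End.mul_apply, hc', hd', smul_smul]

/-- The generator `1 ⊗ v` of the induced module. -/
def inducedBase : Induced (parabolic F α) (parabolicRep F α) :=
  Submodule.Quotient.mk (1 ⊗ₜ[F] tensorBase F α)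

theorem mk_tmul (a : ZeroHecke F n) (v : RowTensor F α) :
    (Submodule.Quotient.mk (a ⊗ₜ[F] v) : Induced (parabolic F α) (parabolicRep F α)) =
      a • tensorCoord F α v • inducedBase F α := by
  conv_lhs => rw [← tensorCoord_smul_tensorBase F α v]
  rw [inducedBase, ← Submodule.Quotient.mk_smul, ← Submodule.Quotient.mk_smul,
    TensorProduct.tmul_smul, smul_comm a, TensorProduct.smul_tmul' a, smul_eq_mul, mul_one]

theorem piBar_smul_inducedBase {i : Fin (n - 1)} (hi : (i : ℕ) + 1 ∉ descentSet α) :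
    piBar F i • inducedBase F α = 0 := by
  have h : piBar F i ∈ parabolic F α := Algebra.subset_adjoin ⟨i, hi, rfl⟩
  rw [inducedBase, ← Submodule.Quotient.mk_smul, Submodule.Quotient.mk_eq_zero]
  refine Submodule.subset_span ⟨1, ⟨_, h⟩, tensorBase F α, ?_⟩
  rw [parabolicRep_piBar F α hi h, TensorProduct.tmul_zero, one_mul,
    TensorProduct.smul_tmul', smul_eq_mul, mul_one]
  exact (sub_zero (piBar F i ⊗ₜ[F] tensorBase F α)).symm

/-- The homomorphism `a ⊗ v ↦ a v`, where `v` is taken as a multiple of the base tableau. -/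
def tensorToRowSum : ZeroHecke F n ⊗[F] RowTensor F α →ₗ[ZeroHecke F n]
    RibbonModule F (rowSum α) :=
  TensorProduct.AlgebraTensorModule.lift (LinearMap.toSpanSingleton (ZeroHecke F n)
    (RowTensor F α →ₗ[F] RibbonModule F (rowSum α))
    ((tensorCoord F α).smulRight (single F (rowSumBase α))))

theorem tensorToRowSum_tmul (a : ZeroHecke F n) (v : RowTensor F α) :
    tensorToRowSum F α (a ⊗ₜ v) = a • tensorCoord F α v • single F (rowSumBase α) := rfl

theorem balancingSubmodule_le_ker :
    balancingSubmodule (parabolic F α) (parabolicRep F α) ≤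
      LinearMap.ker (tensorToRowSum F α) := by
  refine Submodule.span_le.2 ?_
  rintro _ ⟨a, b, v, rfl⟩
  obtain ⟨c, hc, hc'⟩ := exists_eigenvalue F α b
  rw [SetLike.mem_coe, LinearMap.mem_ker, map_sub, sub_eq_zero, tensorToRowSum_tmul,
    tensorToRowSum_tmul, hc', mul_smul, smul_comm (b : ZeroHecke F n), hc, map_smul, smul_eq_mul,
    smul_smul, mul_comm]

/-- `M_α` is induced from `P_{α₁} ⊗ ⋯ ⊗ P_{α_ℓ}`. -/
def inducedEquiv : RibbonModule F (rowSum α) ≃ₗ[ZeroHecke F n]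
    Induced (parabolic F α) (parabolicRep F α) :=
  LinearEquiv.ofLinearMap
    (RowSumModule.desc (inducedBase F α) fun _ hi => piBar_smul_inducedBase F α hi)
    (Submodule.liftQ _ (tensorToRowSum F α) (balancingSubmodule_le_ker F α))
    (by
      refine Submodule.linearMap_qext _ (LinearMap.ext fun t => ?_)
      induction t using TensorProduct.induction_on with
      | zero => simp
      | add s t hs ht => rw [map_add, hs, ht, map_add]
      | tmul a v =>
        change RowSumModule.desc (inducedBase F α)
          (fun _ hi => piBar_smul_inducedBase F α hi) (tensorToRowSum F α (a ⊗ₜ v)) =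
          Submodule.Quotient.mk (a ⊗ₜ v)
        rw [mk_tmul, tensorToRowSum_tmul, map_smul, ← algebraMap_smul (ZeroHecke F n) (tensorCoord F α v), map_smul,
          RowSumModule.desc_rowSumBase, algebraMap_smul])
    (by
      refine RowSumModule.hom_ext ?_
      rw [LinearMap.comp_apply, RowSumModule.desc_rowSumBase, inducedBase, Submodule.liftQ_apply,
        tensorToRowSum_tmul, tensorCoord_tensorBase, one_smul, one_smul]
      rfl)

end RowModule

/-! ## `M_α` as a direct sum of ribbon modules -/

theorem Fin.rel_of_forall_letter {n : ℕ} {γ : Type*} (r : γ → γ → Prop) [IsTrans γ r]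
    (f : Fin n → γ) {p q : Fin n} (hpq : p < q)
    (h : ∀ i : Fin (n - 1), p ≤ letter i → nextLetter i ≤ q →
      r (f (letter i)) (f (nextLetter i))) : r (f p) (f q) := by
  obtain ⟨p, hp⟩ := p
  obtain ⟨q, hq⟩ := q
  have hpq : p + 1 ≤ q := hpq
  induction q, hpq using Nat.le_induction with
  | base => exact h ⟨p, by omega⟩ le_rfl le_rfl
  | succ q hpq ih =>
    have h1 : p ≤ q := by omega
    refine _root_.trans (ih (by omega) ‹_› fun i hi hi' => h i hi (hi'.trans ?_))
      (h ⟨q, by omega⟩ h1 le_rfl)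
    exact Nat.le_succ q

/-! ### Compositions from descent sets, and merging of rows -/

namespace Composition

variable {n : ℕ}

/-- Compositions of `n` correspond to subsets of `{1, …, n - 1}`. -/
def descentEquiv (n : ℕ) : Composition n ≃ Finset (Fin (n - 1)) :=
  (compositionEquiv n).trans (compositionAsSetEquiv n)

theorem mem_descentEquiv (c : Composition n) (i : Fin (n - 1)) :
    i ∈ descentEquiv n c ↔ (i : ℕ) + 1 ∈ descentSet c := by
  have h1 : i ∈ descentEquiv n c ↔ ∃ k : Fin (c.length + 1), c.sizeUpTo k = 1 + i := by
    have h : i ∈ descentEquiv n c ↔ (⟨1 + i, by omega⟩ : Fin (n + 1)) ∈ c.boundaries :=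
      Set.mem_toFinset
    simp only [h, boundaries, Finset.mem_map, Finset.mem_univ, true_and, Fin.ext_iff]
    rfl
  rw [h1, mem_descentSet]
  constructor
  · rintro ⟨k, hk⟩
    refine ⟨k, Nat.pos_of_ne_zero fun h => ?_, lt_of_le_of_ne (Nat.lt_succ_iff.1 k.2) fun h => ?_,
      by omega⟩
    · rw [h, sizeUpTo_zero] at hk; omega
    · rw [h, sizeUpTo_length] at hk; omega
  · rintro ⟨k, -, hkl, hk⟩
    exact ⟨⟨k, by omega⟩, by simp only; omega⟩

theorem exists_descentSet (S : Finset (Fin (n - 1))) :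
    ∃ c : Composition n, ∀ i : Fin (n - 1), (i : ℕ) + 1 ∈ descentSet c ↔ i ∈ S :=
  ⟨(descentEquiv n).symm S, fun i => by rw [← mem_descentEquiv, Equiv.apply_symm_apply]⟩

theorem ext_descentSet {c d : Composition n}
    (h : ∀ i : Fin (n - 1), (i : ℕ) + 1 ∈ descentSet c ↔ (i : ℕ) + 1 ∈ descentSet d) : c = d :=
  (descentEquiv n).injective (Finset.ext fun i => by rw [mem_descentEquiv, mem_descentEquiv, h i])

theorem exists_eq_of_mem_descentSet {c : Composition n} {d : ℕ} (h : d ∈ descentSet c) :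
    ∃ i : Fin (n - 1), (i : ℕ) + 1 = d := by
  obtain ⟨k, hk, hkl, rfl⟩ := c.mem_descentSet.1 h
  have h1 := c.sizeUpTo_strict_mono hkl
  have h2 := c.sizeUpTo_le (k + 1)
  have h3 := c.sizeUpTo_strict_mono (show 0 < c.length by omega)
  have h4 := c.monotone_sizeUpTo (show 0 + 1 ≤ k from hk)
  exact ⟨⟨c.sizeUpTo k - 1, by omega⟩, by simp only; omega⟩

/-- The block index grows by at most one per step. Equality over an interval therefore forces every
step to be a block boundary, as happens inside a column of a ribbon. -/
theorem index_add_le (c : Composition n) {p q : Fin n} (h : p ≤ q) :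
    (c.index q : ℕ) + p ≤ c.index p + q := by
  rcases h.lt_or_eq with h | rfl
  · have : (c.index p : ℤ) - (p : ℕ) ≥ (c.index q : ℤ) - (q : ℕ) :=
      Fin.rel_of_forall_letter (· ≥ ·) (fun p => (c.index p : ℤ) - (p : ℕ)) h fun i _ _ => by
        have := c.index_nextLetter_le i
        simp only [letter, nextLetter] at *
        omega
    omega
  · exact le_rfl

/-- The row of `β` that contains a row of `α`, where `β ≼ α`. -/
def coarsen (α β : Composition n) (r : Fin α.length) : ℕ :=
  β.index (α.embedding r ⟨0, α.one_le_blocksFun r⟩)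

theorem coarsen_monotone (α β : Composition n) : Monotone (coarsen α β) := by
  intro r s h
  refine β.index_monotone ?_
  rw [Fin.le_def, coe_embedding, coe_embedding]
  exact α.monotone_sizeUpTo h

theorem index_eq_of_refinedBy {α β : Composition n} (h : RefinedBy β α) {p q : Fin n}
    (hpq : α.index p = α.index q) : β.index p = β.index q := by
  wlog hle : p < q generalizing p q
  · rcases (not_lt.1 hle).lt_or_eq with h' | h'
    · exact (this hpq.symm h').symm
    · rw [h']
  refine Fin.rel_of_forall_letter (· = ·) β.index hle fun i hi hi' => ?_
  refine β.index_nextLetter_eq_iff.2 fun hd => α.index_nextLetter_eq_iff.1 ?_ (h hd)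
  refine le_antisymm (α.index_monotone ?_) ?_
  · simp [Fin.le_def, letter, nextLetter]
  · exact (α.index_monotone hi').trans (hpq.symm.le.trans (α.index_monotone hi))

theorem coarsen_index {α β : Composition n} (h : RefinedBy β α) (p : Fin n) :
    coarsen α β (α.index p) = β.index p := by
  rw [coarsen, index_eq_of_refinedBy h (q := p)]
  rw [α.index_embedding]

end Composition

/-! ### Descents of ribbon tableaux, fibres and the count of tableaux -/

namespace StandardTableau

open GeneralizedRibbon

variable {n : ℕ}

instance (R : GeneralizedRibbon n) : Fintype (StandardTableau R) :=
  Fintype.ofInjective perm perm_injective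

/-- At a row boundary the next box lies directly above, so the column condition forces a descent;
inside a row there is an ascent. Hence the reading word determines the shape `β`. -/
theorem mem_descentSet_iff {β : Composition n} (τ : StandardTableau (ribbon β)) (i : Fin (n - 1)) :
    (i : ℕ) + 1 ∈ descentSet β ↔ τ.perm (nextLetter i) < τ.perm (letter i) := by
  constructor
  · intro h
    have h1 := β.index_nextLetter_of_mem h
    obtain ⟨b, hb⟩ := (ribbon β).position.surjective (letter i)
    obtain ⟨c, hc⟩ := (ribbon β).position.surjective (nextLetter i)
    have h2 := col_ribbon β b
    have h3 := col_ribbon β c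
    have h4 : β.index (letter i) = b.1 := by rw [← hb]; exact index_position _ b
    have h5 : β.index (nextLetter i) = c.1 := by rw [← hc]; exact index_position _ c
    rw [h4, h5] at h1
    rw [hb] at h2
    rw [hc] at h3
    rw [← hb, ← hc, perm_position, perm_position]
    simp only [letter, nextLetter] at h2 h3
    refine τ.col_lt b c ?_ (Fin.lt_def.2 ?_)
    · have : ((c.1 : Fin _) : ℕ) = (b.1 : Fin _) + 1 := h1
      omega
    · have : ((c.1 : Fin _) : ℕ) = (b.1 : Fin _) + 1 := h1
      omega
  · intro h
    by_contra h'
    refine lt_asymm h (τ.perm_lt (β.index_nextLetter_eq_iff.2 h') ?_)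
    simp [Fin.lt_def, letter, nextLetter]

/-- The tableau of ribbon shape `β` whose reading word has descent set `D(β)`. -/
def ribbonOfPerm {β : Composition n} (w : Equiv.Perm (Fin n))
    (h : ∀ i : Fin (n - 1), (i : ℕ) + 1 ∈ descentSet β ↔ w (nextLetter i) < w (letter i)) :
    StandardTableau (ribbon β) :=
  ofPerm w
    (fun p q hpq hlt => by
      refine Fin.rel_of_forall_letter (· < ·) w hlt fun i hi hi' => ?_
      have h1 : (i : ℕ) + 1 ∉ descentSet β := by
        rw [← β.index_nextLetter_eq_iff]
        refine le_antisymm (β.index_monotone ?_) ?_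
        · simp [Fin.le_def, letter, nextLetter]
        · exact (β.index_monotone hi').trans (hpq.symm.le.trans (β.index_monotone hi))
      rw [h i, not_lt] at h1
      refine lt_of_le_of_ne h1 fun h2 => ?_
      have := congrArg Fin.val (w.injective h2)
      simp [letter, nextLetter] at this)
    (fun b c hbc hlt => by
      have hb := col_ribbon β b
      have hc := col_ribbon β c
      have hlt' : ((b.1 : Fin _) : ℕ) < (c.1 : Fin _) := hlt
      have hib : β.index ((ribbon β).position b) = b.1 := index_position _ b
      have hic : β.index ((ribbon β).position c) = c.1 := index_position _ c
      -- Two boxes in one column differ equally in position and in row, so by `index_add_le` every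
      -- step between them crosses a row boundary and is a descent of `w`.
      refine Fin.rel_of_forall_letter (· > ·) w (Fin.lt_def.2 (by omega)) fun i hi hi' => ?_
      rw [gt_iff_lt, ← h i]
      by_contra hd
      have h1 := congrArg Fin.val (β.index_nextLetter_of_notMem hd)
      have h2 := β.index_add_le hi
      have h3 := β.index_add_le hi'
      rw [hib] at h2
      rw [hic] at h3
      simp only [letter, nextLetter] at *
      omega)

theorem perm_ribbonOfPerm {β : Composition n} (w : Equiv.Perm (Fin n)) (h) :
    (ribbonOfPerm (β := β) w h).perm = w := perm_ofPerm w _ _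

theorem coarsen_row {α β : Composition n} (h : RefinedBy β α) (f : StandardTableau (rowSum α))
    (x : Fin n) : Composition.coarsen α β (f.row x) = β.index (f.perm.symm x) := by
  rw [row_eq]
  exact Composition.coarsen_index h _

open Classical in
/-- The tableaux of shape `α₁ ⊕ ⋯ ⊕ α_ℓ` whose letters lie in the rows of a tableau of shape
`β ≼ α`, after each row of `α` has been sent to the row of `β` that contains it. -/
def fiber (α : Composition n) {β : Composition n} (τ : StandardTableau (ribbon β)) :
    Finset (StandardTableau (rowSum α)) :=
  Finset.univ.filter fun f => ∀ x, Composition.coarsen α β (f.row x) = τ.row x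

theorem mem_fiber {α β : Composition n} {τ : StandardTableau (ribbon β)}
    {f : StandardTableau (rowSum α)} :
    f ∈ fiber α τ ↔ ∀ x, Composition.coarsen α β (f.row x) = τ.row x := by
  simp [fiber]

theorem mem_fiber_of_perm_eq {α β : Composition n} (h : RefinedBy β α)
    {τ : StandardTableau (ribbon β)} {f : StandardTableau (rowSum α)} (hf : τ.perm = f.perm) :
    f ∈ fiber α τ := by
  refine mem_fiber.2 fun x => ?_
  rw [coarsen_row h, row_eq, hf]
  rfl

/-- The reading word of a tableau, in the lexicographic order. -/
def readingWord {R : GeneralizedRibbon n} (τ : StandardTableau R) : Lex (Fin n → Fin n) :=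
  toLex τ.perm

/-- Each row of `β` contains the same letters in `g` as in `τ`, and `τ` lists them in increasing
order, which is the lexicographically smallest arrangement. -/
theorem readingWord_lt {α β : Composition n} (h : RefinedBy β α)
    {τ : StandardTableau (ribbon β)} {f g : StandardTableau (rowSum α)} (hf : τ.perm = f.perm)
    (hg : g ∈ fiber α τ) (hne : g ≠ f) : readingWord f < readingWord g := by
  have hidx (x : Fin n) : β.index (g.perm.symm x) = β.index (τ.perm.symm x) := by
    have h1 := mem_fiber.1 hg x
    rw [coarsen_row h, row_eq] at h1
    exact Fin.ext h1
  rcases lt_trichotomy (readingWord f) (readingWord g) with hlt | heq | ⟨p, hp, hp'⟩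
  · exact hlt
  · refine absurd (perm_injective (Equiv.ext fun p => ?_)) hne
    exact (congrFun (toLex.injective heq) p).symm
  · exfalso
    have hp (q : Fin n) (hq : q < p) : g.perm q = τ.perm q := by rw [hf]; exact hp q hq
    have hp' : g.perm p < τ.perm p := by rw [hf]; exact hp'
    have h1 := hidx (g.perm p)
    rw [Equiv.symm_apply_apply] at h1
    -- At the first difference `p`, the letter of `g` is located in `τ`: a later place contradicts
    -- that the row of `τ` increases, the same place contradicts the difference, and at an earlier
    -- place `g` would already have used it.
    rcases lt_trichotomy p (τ.perm.symm (g.perm p)) with h2 | h2 | h2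
    · have h3 := τ.perm_lt h1 h2
      rw [Equiv.apply_symm_apply] at h3
      exact lt_asymm h3 hp'
    · rw [Equiv.eq_symm_apply] at h2
      exact hp'.ne h2.symm
    · have h3 := hp _ h2
      rw [Equiv.apply_symm_apply] at h3
      exact h2.ne (g.perm.injective h3)

theorem exists_ribbon {α : Composition n} (f : StandardTableau (rowSum α)) :
    ∃ β : Composition n, RefinedBy β α ∧ ∃ τ : StandardTableau (ribbon β), τ.perm = f.perm := by
  classical
  obtain ⟨β, hβ⟩ := Composition.exists_descentSet
    (Finset.univ.filter fun i : Fin (n - 1) => f.perm (nextLetter i) < f.perm (letter i))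
  simp only [Finset.mem_filter, Finset.mem_univ, true_and] at hβ
  refine ⟨β, fun d hd => ?_, ribbonOfPerm f.perm hβ, perm_ribbonOfPerm _ _⟩
  obtain ⟨i, rfl⟩ := Composition.exists_eq_of_mem_descentSet hd
  by_contra h
  refine lt_asymm ((hβ i).1 hd) (f.perm_lt (α.index_nextLetter_eq_iff.2 h) ?_)
  simp [Fin.lt_def, letter, nextLetter]

/-- A ribbon tableau of shape `β ≼ α` is also increasing along the rows of `α`, and its reading word
recovers `β` through its descents. The opposite inequality will follow from surjectivity. -/
theorem card_sigma_le (α : Composition n) [Fintype {β : Composition n // RefinedBy β α}] :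
    Fintype.card (Σ β : {β : Composition n // RefinedBy β α}, StandardTableau (ribbon β.1)) ≤
      Fintype.card (StandardTableau (rowSum α)) := by
  let φ (x : Σ β : {β : Composition n // RefinedBy β α}, StandardTableau (ribbon β.1)) :
      StandardTableau (rowSum α) :=
    rowSumOfPerm x.2.perm fun p q hpq hlt =>
      x.2.perm_lt (Composition.index_eq_of_refinedBy x.1.2 hpq) hlt
  refine Fintype.card_le_of_injective φ ?_
  rintro ⟨⟨β, hβ⟩, τ⟩ ⟨⟨β', hβ'⟩, τ'⟩ h
  have h1 : τ.perm = τ'.perm := by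
    have := congrArg perm h
    rwa [perm_rowSumOfPerm, perm_rowSumOfPerm] at this
  obtain rfl : β = β' := Composition.ext_descentSet fun i => by
    rw [τ.mem_descentSet_iff, τ'.mem_descentSet_iff, h1]
  rw [perm_injective h1]

end StandardTableau

/-! ### The decomposition of `M_α` into ribbon modules -/

namespace RibbonModule

open GeneralizedRibbon StandardTableau ZeroHecke Composition

variable (F : Type*) [Field F] {n : ℕ} {α β : Composition n}

theorem sum_fiber_piBar_same (i : Fin (n - 1)) (τ : StandardTableau (ribbon β))
    (h : τ.row (letter i) = τ.row (nextLetter i)) :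
    ∑ f ∈ fiber α τ, piBar F i • single F f = 0 := by
  -- Exchanging `i` and `i + 1` preserves the fibre, since both are in one row of `τ`. A pair it
  -- exchanges contributes `single F g` and `- single F g`; a fixed tableau has both letters in one
  -- row and contributes zero.
  refine Finset.sum_involution (fun f _ => act i f) (fun f _ => ?_) (fun f _ hf he => hf ?_)
    (fun f hf => ?_) (fun f _ => act_act i f)
  · rcases lt_trichotomy (f.row (letter i)) (f.row (nextLetter i)) with h' | h' | h'
    · rw [piBar_smul_lower h', swap_eq_act, piBar_smul_higher, add_neg_cancel]
      rwa [row_act_letter, row_act_nextLetter]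
    · rw [piBar_smul_same h', piBar_smul_same, add_zero]
      rw [row_act_letter, row_act_nextLetter, h']
    · have h'' : (act i f).row (letter i) < (act i f).row (nextLetter i) := by
        rwa [row_act_letter, row_act_nextLetter]
      rw [piBar_smul_higher h', piBar_smul_lower h'', swap_eq_act, act_act, neg_add_cancel]
  · refine piBar_smul_same ?_
    rw [← row_act_nextLetter, he]
  · rw [mem_fiber] at hf ⊢
    intro x
    rw [row_act, hf]
    by_cases h1 : x = letter i
    · rw [h1, Equiv.swap_apply_left, h]
    by_cases h2 : x = nextLetter i
    · rw [h2, Equiv.swap_apply_right, h]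
    rw [Equiv.swap_apply_of_ne_of_ne h1 h2]

/-- Merging rows is monotone, so it reflects strict inequalities. Hence letters in different rows of
`τ` compare the same way in every term of the fibre, and `π̄_i` acts on the sum term by term. -/
theorem row_lt_of_mem_fiber {τ : StandardTableau (ribbon β)} {f : StandardTableau (rowSum α)}
    (hf : f ∈ fiber α τ) {x y : Fin n} (h : τ.row x < τ.row y) : f.row x < f.row y := by
  rw [mem_fiber] at hf
  refine (coarsen_monotone α β).reflect_lt ?_
  rw [hf, hf]
  exact h

theorem act_mem_fiber {τ : StandardTableau (ribbon β)} {f : StandardTableau (rowSum α)}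
    (hf : f ∈ fiber α τ) (i : Fin (n - 1)) (h : τ.row (letter i) < τ.row (nextLetter i)) :
    act i f ∈ fiber α (τ.swap i h) := by
  rw [mem_fiber] at hf ⊢
  intro x
  rw [row_act, hf, row_swap]

theorem act_mem_fiber_of_swap {τ : StandardTableau (ribbon β)} {f : StandardTableau (rowSum α)}
    (i : Fin (n - 1)) (h : τ.row (letter i) < τ.row (nextLetter i))
    (hf : f ∈ fiber α (τ.swap i h)) : act i f ∈ fiber α τ := by
  rw [mem_fiber] at hf ⊢
  intro x
  rw [row_act, hf, row_swap, Equiv.swap_apply_self]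

variable (α β) in
/-- The embedding of `P_β` into `M_α` for `β ≼ α`. -/
def toRowSum : RibbonModule F (ribbon β) →ₗ[ZeroHecke F n] RibbonModule F (rowSum α) :=
  lift (fun τ => ∑ f ∈ fiber α τ, single F f)
    (fun i τ h => by
      rw [Finset.smul_sum, ← Finset.sum_neg_distrib]
      exact Finset.sum_congr rfl fun f hf => piBar_smul_higher (row_lt_of_mem_fiber hf h))
    (fun i τ h => by rw [Finset.smul_sum]; exact sum_fiber_piBar_same F i τ h)
    (fun i τ h => by
      rw [Finset.smul_sum]
      refine Finset.sum_bij' (fun f _ => act i f) (fun f _ => act i f)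
        (fun f hf => act_mem_fiber hf i h) (fun f hf => act_mem_fiber_of_swap i h hf)
        (fun f _ => act_act i f) (fun f _ => act_act i f) fun f hf => ?_
      rw [piBar_smul_lower (row_lt_of_mem_fiber hf h), swap_eq_act])

theorem toRowSum_single (τ : StandardTableau (ribbon β)) :
    toRowSum F α β (single F τ) = ∑ f ∈ fiber α τ, single F f := lift_single _ _ _ _ _

variable (α)

open Classical in
/-- The sum of the embeddings of the `P_β` with `β ≼ α` into `M_α`. -/
def sumToRowSum : (⨁ β : {β : Composition n // RefinedBy β α}, RibbonModule F (ribbon β.1))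
    →ₗ[ZeroHecke F n] RibbonModule F (rowSum α) :=
  DirectSum.toModule _ _ _ fun β => toRowSum F α β.1

theorem sumToRowSum_surjective : Function.Surjective (sumToRowSum F α) := by
  classical
  rw [← LinearMap.range_eq_top, eq_top_iff]
  rintro v -
  induction v using RibbonModule.induction with
  | zero => exact zero_mem _
  | add v w hv hw => exact add_mem hv hw
  | smul c v hv => rw [← algebraMap_smul (ZeroHecke F n)]; exact Submodule.smul_mem _ _ hv
  | single f =>
    -- Descending induction: `f` is the smallest term of the image of the ribbon tableau with its
    -- reading word, and all other terms are already in the range.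
    induction hw : readingWord f using WellFoundedGT.induction generalizing f with
    | ind w ih =>
    subst hw
    obtain ⟨β, hβ, τ, hτ⟩ := exists_ribbon f
    have h1 : sumToRowSum F α (DirectSum.lof (ZeroHecke F n) _
        (fun β : {β : Composition n // RefinedBy β α} => RibbonModule F (ribbon β.1)) ⟨β, hβ⟩
          (single F τ)) = ∑ f ∈ fiber α τ, single F f := by
      rw [sumToRowSum, DirectSum.toModule_lof, toRowSum_single]
    rw [← Finset.add_sum_erase _ _ (mem_fiber_of_perm_eq hβ hτ), ← sub_eq_iff_eq_add] at h1
    rw [← h1]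
    refine sub_mem ⟨_, rfl⟩ (sum_mem fun g hg => ?_)
    rw [Finset.mem_erase] at hg
    exact ih _ (readingWord_lt hβ hτ hg.2 hg.1) g rfl

instance (R : GeneralizedRibbon n) : Module.Finite F (RibbonModule F R) :=
  inferInstanceAs (Module.Finite F (StandardTableau R →₀ F))

theorem finrank_eq_card (R : GeneralizedRibbon n) :
    Module.finrank F (RibbonModule F R) = Fintype.card (StandardTableau R) :=
  Module.finrank_finsupp_self F

instance : IsScalarTower F (ZeroHecke F n)
    (⨁ β : {β : Composition n // RefinedBy β α}, RibbonModule F (ribbon β.1)) :=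
  ⟨fun c a v => by ext i; simp [DirectSum.smul_apply]⟩

theorem sumToRowSum_bijective : Function.Bijective (sumToRowSum F α) := by
  classical
  have hs := sumToRowSum_surjective F α
  refine ⟨?_, hs⟩
  let φ := (sumToRowSum F α).restrictScalars F
  have : Fintype {β : Composition n // RefinedBy β α} := Fintype.ofFinite _
  have h1 : Module.finrank F (⨁ β : {β : Composition n // RefinedBy β α},
      RibbonModule F (ribbon β.1)) ≤ Module.finrank F (RibbonModule F (rowSum α)) := by
    rw [Module.finrank_directSum, finrank_eq_card]
    simp only [finrank_eq_card]
    rw [← Fintype.card_sigma]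
    exact card_sigma_le α
  -- A surjection onto `M_α` cannot start from a smaller dimension, so the dimensions agree and
  -- surjectivity implies injectivity.
  have h2 := h1.antisymm (LinearMap.finrank_le_finrank_of_surjective (f := φ) hs)
  exact (LinearMap.injective_iff_surjective_of_finrank_eq_finrank (f := φ) h2).2 hs

end RibbonModule

end

theorem mainTheorem3 (F : Type*) [Field F] (n : ℕ) (α : Composition n) :
    (∃ e : parabolic F α ≃ₐ[F] BlockTensor F α,
      (∀ (r : Fin α.length) (p : Fin (α.blocksFun r - 1)),
        ((e.symm (PiTensorProduct.singleAlgHom r (ZeroHecke.piBar F p)) : parabolic F α) :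
          ZeroHecke F n) = ZeroHecke.piBar F (blockIndex α r p)) ∧
      Nonempty (RibbonModule F (GeneralizedRibbon.rowSum α) ≃ₗ[ZeroHecke F n]
        Induced (parabolic F α) ((rowTensorRep F α).comp (e : parabolic F α →ₐ[F] BlockTensor F α)))) ∧
    Nonempty (RibbonModule F (GeneralizedRibbon.rowSum α) ≃ₗ[ZeroHecke F n]
      ⨁ β : {β : Composition n // RefinedBy β α},
        RibbonModule F (GeneralizedRibbon.ribbon β.1)) := by
  exact ⟨⟨parabolicEquiv F α, parabolicEquiv_symm_single F α, ⟨RowModule.inducedEquiv F α⟩⟩,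
    ⟨(LinearEquiv.ofBijective (RibbonModule.sumToRowSum F α)
      (RibbonModule.sumToRowSum_bijective F α)).symm⟩⟩
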